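/- Let $d\ge 1$ and let $V(z,\omega)$, $z\in\mathbb Z^d$, be i.i.d. random variables with values in $[0,\infty]$ on a probability space $(\Omega,\mathcal F,\mathbb P)$ such that $\mathbb P(V(0)=0)<1$ and $\operatorname{ess\,inf}_{\omega\in\Omega}V(0,\omega)=0$. If $d=1$, assume in addition that $\mathbb P(V(0)\in(0,\infty))>0$. Let $P^0$, with expectation $E^0$, be the law of the simple symmetric nearest-neighbour random walk $(S_n)_{n\ge 0}$ on $\mathbb Z^d$ started at $0$. For $y\in\mathbb Z^d\setminus\{0\}$ let $\tau_y=\inf\{n\ge 0: S_n=y\}$, let $$Z^0_y=\mathbb E\,E^0\Big(\mathbf 1_{\{\tau_y<\infty\}}\,e^{-\sum_{n=0}^{\tau_y-1}V(S_n,\omega)}\Big),$$ and let $Q^0_y$ be the annealed path measure $$Q^0_y(A)=\frac1{Z^0_y}\,\mathbb E\,E^0\Big(\mathbf 1_{\{\tau_y<\infty\}}\,\mathbf 1_A\,e^{-\sum_{n=0}^{\tau_y-1}V(S_n,\omega)}\Big).$$ Then there is a constant $C\in(0,\infty)$ such that $$\limsup_{\|y\|\to\infty}\frac{E_{Q^0_y}(\tau_y)}{\|y\|}\le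 C,$$ where $\|\cdot\|$ is the Euclidean norm. -/

import Mathlib

open MeasureTheory ProbabilityTheory Filter
open scoped ENNReal

noncomputable section

namespace RWPotential

/-- The integer lattice `ℤ^d`. -/
abbrev Lattice (d : ℕ) : Type := Fin d → ℤ

/-- Trajectories in `ℤ^d` indexed by discrete time, with the product σ-algebra. -/
abbrev Path (d : ℕ) : Type := ℕ → Lattice d

/-- The Euclidean norm of a lattice point. -/
def latticeNorm {d : ℕ} (y : Lattice d) : ℝ :=
  ‖(WithLp.toLp 2 (fun i => (y i : ℝ)) : EuclideanSpace ℝ (Fin d))‖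

/-- The law of one step of the simple symmetric walk: uniform on the `2d` vectors `±e_i`. -/
def stepLaw (d : ℕ) : Measure (Lattice d) :=
  (2 * (d : ℝ≥0∞))⁻¹ •
    ∑ i : Fin d, (Measure.dirac (Pi.single i (1 : ℤ)) + Measure.dirac (Pi.single i (-1 : ℤ)))

/-- The law `P^x` on paths of the simple symmetric random walk started at `x`: the law of
`n ↦ x + ξ_0 + ⋯ + ξ_{n-1}` with i.i.d. uniform nearest-neighbour steps `ξ_k`. -/
def walkLaw {d : ℕ} (x : Lattice d) : Measure (Path d) :=
  (Measure.infinitePi (fun _ : ℕ => stepLaw d)).map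
    (fun ξ n => x + ∑ k ∈ Finset.range n, ξ k)

/-- The hitting time `τ_y = inf {n ≥ 0 : S_n = y}`, equal to `⊤` if `y` is never hit. -/
def hitTime {d : ℕ} (y : Lattice d) (S : Path d) : ℕ∞ :=
  ⨅ (n : ℕ) (_ : S n = y), (n : ℕ∞)

/-- The weight `1_{τ_y < ∞} exp (- ∑_{n=0}^{τ_y - 1} v (S_n))` of the path `S` in the
potential `v`, with `exp (-∞) = 0`. -/
def weight {d : ℕ} (v : Lattice d → ℝ≥0∞) (y : Lattice d) (S : Path d) : ℝ≥0∞ :=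
  if hitTime y S = ⊤ then 0
  else EReal.exp (-((∑ n ∈ Finset.range (hitTime y S).toNat, v (S n) : ℝ≥0∞) : EReal))

/-- The quenched partition function `Z^{v,x}_y` in the potential `v`. -/
def quenchedPartition {d : ℕ} (v : Lattice d → ℝ≥0∞) (x y : Lattice d) : ℝ≥0∞ :=
  ∫⁻ S, weight v y S ∂(walkLaw x)

variable {d : ℕ} {Ω : Type*} [MeasurableSpace Ω]

/-- The annealed partition function `Z^x_y = 𝔼 Z^{ω,x}_y`. -/
def annealedPartition (μ : Measure Ω) (V : Lattice d → Ω → ℝ≥0∞) (x y : Lattice d) : ℝ≥0∞ :=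
  ∫⁻ ω, quenchedPartition (fun z => V z ω) x y ∂μ

/-- The annealed path measure `Q^x_y`: the path marginal of the measure on environments and
paths with density `weight / Z^x_y` with respect to `μ ⊗ P^x`. For a measurable potential it is
`A ↦ (Z^x_y)⁻¹ 𝔼 E^x (1_{τ_y < ∞} 1_A exp (- ∑_{n < τ_y} V (S_n)))`, see
`annealedMeasure_apply`. -/
def annealedMeasure (μ : Measure Ω) (V : Lattice d → Ω → ℝ≥0∞) (x y : Lattice d) :
    Measure (Path d) :=
  (annealedPartition μ V x y)⁻¹ •
    ((μ.prod (walkLaw x)).withDensity (fun p => weight (fun z => V z p.1) y p.2)).map Prod.snd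

/-- The annealed expected hitting time `E_{Q^x_y} (τ_y)`, with values in `[0, ∞]`. -/
def annealedHitTime (μ : Measure Ω) (V : Lattice d → Ω → ℝ≥0∞) (x y : Lattice d) : ℝ≥0∞ :=
  ∫⁻ S, (hitTime y S : ℝ≥0∞) ∂(annealedMeasure μ V x y)

instance isProbabilityMeasure_stepLaw [NeZero d] : IsProbabilityMeasure (stepLaw d) := by
  constructor
  have hd : (d : ℝ≥0∞) ≠ 0 := by exact_mod_cast NeZero.ne d
  simp only [stepLaw, Measure.smul_apply, Measure.coe_finsetSum, Finset.sum_apply,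
    Measure.add_apply, measure_univ, Finset.sum_const, Finset.card_univ, Fintype.card_fin,
    nsmul_eq_mul, smul_eq_mul]
  rw [one_add_one_eq_two, mul_comm (d : ℝ≥0∞) 2]
  exact ENNReal.inv_mul_cancel (mul_ne_zero two_ne_zero hd)
    (ENNReal.mul_ne_top ENNReal.ofNat_ne_top (ENNReal.natCast_ne_top d))

instance isProbabilityMeasure_walkLaw [NeZero d] (x : Lattice d) :
    IsProbabilityMeasure (walkLaw x) :=
  Measure.isProbabilityMeasure_map (by fun_prop)

theorem hitTime_eq_coe_iff (y : Lattice d) (S : Path d) (n : ℕ) :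
    hitTime y S = n ↔ S n = y ∧ ∀ m < n, S m ≠ y := by
  constructor
  · intro h
    have h1 : ∀ m < n, S m ≠ y := by
      intro m hm hS
      have : hitTime y S ≤ m := iInf₂_le m hS
      rw [h] at this
      exact absurd (by exact_mod_cast this) (not_le.2 hm)
    refine ⟨?_, h1⟩
    by_contra hn
    have : ((n + 1 : ℕ) : ℕ∞) ≤ hitTime y S := by
      refine le_iInf₂ fun m hm => ?_
      rcases lt_trichotomy m n with h2 | h2 | h2
      · exact absurd hm (h1 m h2)
      · exact absurd (h2 ▸ hm) hn
      · exact_mod_cast h2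
    rw [h] at this
    have h3 : n + 1 ≤ n := by exact_mod_cast this
    omega
  · rintro ⟨h1, h2⟩
    refine le_antisymm (iInf₂_le n h1) (le_iInf₂ fun m hm => ?_)
    by_contra hlt
    exact h2 m (by exact_mod_cast not_le.1 hlt) hm

theorem measurable_hitTime (y : Lattice d) : Measurable (hitTime y) := by
  have key : ∀ n : ℕ, MeasurableSet (hitTime y ⁻¹' {(n : ℕ∞)}) := by
    intro n
    have hset : hitTime y ⁻¹' {(n : ℕ∞)} =
        (fun S : Path d => S n) ⁻¹' {y} ∩ ⋂ m ∈ Finset.range n, (fun S : Path d => S m) ⁻¹' {y}ᶜ := by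
      ext S
      simp [hitTime_eq_coe_iff]
    rw [hset]
    refine (measurable_pi_apply n (measurableSet_singleton y)).inter
      (Finset.measurableSet_biInter _ fun m _ => ?_)
    exact measurable_pi_apply m (measurableSet_singleton y).compl
  refine measurable_to_countable' fun k => ?_
  induction k using ENat.recTopCoe with
  | coe n => exact key n
  | top =>
    have hset : hitTime y ⁻¹' {(⊤ : ℕ∞)} = (⋃ n : ℕ, hitTime y ⁻¹' {(n : ℕ∞)})ᶜ := by
      ext S
      simp only [Set.mem_preimage, Set.mem_singleton_iff, Set.mem_compl_iff, Set.mem_iUnion]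
      constructor
      · rintro h ⟨n, hn⟩
        exact ENat.natCast_ne_top n (hn.symm.trans h)
      · intro h
        by_contra hne
        exact h ⟨_, (ENat.natCast_toNat hne).symm⟩
    rw [hset]
    exact (MeasurableSet.iUnion key).compl

theorem measurable_weight {V : Lattice d → Ω → ℝ≥0∞} (hV : ∀ z, Measurable (V z))
    (y : Lattice d) :
    Measurable (fun p : Ω × Path d => weight (fun z => V z p.1) y p.2) := by
  have hVj : Measurable (fun q : Lattice d × Ω => V q.1 q.2) :=
    measurable_from_prod_countable_right hV
  have hg : Measurable (fun q : ℕ∞ × (Ω × Path d) => if q.1 = ⊤ then (0 : ℝ≥0∞)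
      else EReal.exp
        (-((∑ n ∈ Finset.range q.1.toNat, V (q.2.2 n) q.2.1 : ℝ≥0∞) : EReal))) := by
    refine measurable_from_prod_countable_right fun k => ?_
    by_cases hk : k = ⊤
    · simp [hk]
    · simp only [hk, if_false]
      have hsum : Measurable (fun p : Ω × Path d =>
          ∑ n ∈ Finset.range k.toNat, V (p.2 n) p.1) := by
        refine Finset.measurable_fun_sum _ fun n _ => ?_
        have hn : Measurable (fun p : Ω × Path d => p.2 n) :=
          (measurable_pi_apply n).comp measurable_snd
        exact hVj.comp (hn.prodMk measurable_fst)
      exact (measurable_coe_ennreal_ereal.comp hsum).neg.ereal_exp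
  exact hg.comp (((measurable_hitTime y).comp measurable_snd).prodMk measurable_id)

/-- The defining formula of the annealed path measure, as an iterated expectation. -/
theorem annealedMeasure_apply [NeZero d] (μ : Measure Ω) [SFinite μ]
    {V : Lattice d → Ω → ℝ≥0∞} (hV : ∀ z, Measurable (V z)) (x y : Lattice d)
    {A : Set (Path d)} (hA : MeasurableSet A) :
    annealedMeasure μ V x y A = (annealedPartition μ V x y)⁻¹ *
      ∫⁻ ω, ∫⁻ S, A.indicator (weight (fun z => V z ω) y) S ∂(walkLaw x) ∂μ := by
  have hm := measurable_weight hV y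
  have hs : MeasurableSet (Prod.snd ⁻¹' A : Set (Ω × Path d)) := measurable_snd hA
  rw [annealedMeasure, Measure.smul_apply, smul_eq_mul, Measure.map_apply measurable_snd hA,
    withDensity_apply _ hs, ← lintegral_indicator hs,
    lintegral_prod _ (hm.indicator hs).aemeasurable]
  rfl

end RWPotential

end

noncomputable section

namespace RWPotential

variable {d : ℕ}

/-! Put f = exp(-V) and let G be the Green kernel of the walk that survives a visit to z with
probability f z and is stopped at y. The quenched mean of the hitting time times the weight is at
most the sum over x of G(o,x) G(x,y), in which a site counts as often as it is visited. The heart of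
the proof is that, after averaging over the environment, this sum is at most a constant times the
sum over u of the weight of the paths through u, which counts each visited site once
(`lintegral_green_green_le_through`).

For this comparison call a site a trap if f ≤ ρ < 1 there. Fix x, let R be the distance from x to
the nearest trap and B the cube of radius R around x. A trap in B bounds the Green function with
pole in B by K(R). Splitting the path at its first entrance u into B and its last exit v from B then
leaves K(R)² times weights that depend only on the environment off B. The absence of traps within
distance R - 1, of probability q^((2R-1)^d), is independent of these weights, and a fresh
environment in B joins u to v again at an annealed cost of at least α(R)β (`lintegral_box_le`).
Summing over x and R, everything reduces to the convergence of the series with terms K² q^((2R-1)^d)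
/ α times a polynomial volume factor.

In dimension at least two, K and 1/α grow exponentially in R while q^((2R-1)^d) decays faster than
any exponential. In dimension one all decay is exponential and the rates must be compared. There K
is only linear, and the annealed weight of crossing L sites decays at a rate θ strictly larger than
p = P(V = 0). Indeed a gap of g free sites between sites with 0 < V < ∞ has probability of order p^g
and is crossed with probability of order 1/(g+1), and the divergence of the harmonic series lifts
the renewal rate above p (`exists_rate_of_pos`, `le_lintegral_crossWeight`). A trap level with q < θ
then makes the series converge.

It remains to count distinct sites. A path visiting c sites before reaching y has annealed weight at
most β^c with β = E f < 1, whereas the partition function is at least exponential in the distance to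
y, as a single geodesic shows. Hence paths visiting more than a large multiple of that distance
contribute only a bounded multiple of the partition function (`tsum_lintegral_throughWeight_le`,
`limsup_annealedHitTime_le`). -/

/-! ### Potential theory of the killed walk: Green operators and supersolutions. -/

/-- The `2d` unit steps of the lattice, indexed by a coordinate and a sign. -/
def unitStep (s : Fin d × Bool) : Lattice d := Pi.single s.1 (if s.2 then 1 else -1)

/-- The average of `g` over the `2d` neighbours of a lattice point. -/
def nbrAvg (g : Lattice d → ℝ≥0∞) (x : Lattice d) : ℝ≥0∞ :=
  (2 * (d : ℝ≥0∞))⁻¹ * ∑ s : Fin d × Bool, g (x + unitStep s)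

/-- The transition operator of the walk that survives a visit to `x` with weight `f x`. -/
def killedStep (f g : Lattice d → ℝ≥0∞) (x : Lattice d) : ℝ≥0∞ := f x * nbrAvg g x

/-- The Green operator `∑ n, (killedStep f)^n` of the killed walk. -/
def green (f g : Lattice d → ℝ≥0∞) (x : Lattice d) : ℝ≥0∞ := ∑' n : ℕ, (killedStep f)^[n] g x

theorem nbrAvg_mono {g g' : Lattice d → ℝ≥0∞} (h : g ≤ g') : nbrAvg g ≤ nbrAvg g' :=
  fun x => mul_le_mul' le_rfl (Finset.sum_le_sum fun s _ => h (x + unitStep s))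

theorem killedStep_mono {f f' g g' : Lattice d → ℝ≥0∞} (hf : f ≤ f') (hg : g ≤ g') :
    killedStep f g ≤ killedStep f' g' :=
  fun x => mul_le_mul' (hf x) (nbrAvg_mono hg x)

theorem nbrAvg_tsum {ι : Type*} (g : ι → Lattice d → ℝ≥0∞) (x : Lattice d) :
    nbrAvg (fun z => ∑' i, g i z) x = ∑' i, nbrAvg (g i) x := by
  simp only [nbrAvg]
  rw [ENNReal.tsum_mul_left, Summable.tsum_finsetSum fun _ _ => ENNReal.summable]

theorem nbrAvg_add (g g' : Lattice d → ℝ≥0∞) : nbrAvg (g + g') = nbrAvg g + nbrAvg g' := by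
  ext x; simp [nbrAvg, Finset.sum_add_distrib, mul_add]

theorem nbrAvg_mul_const (g : Lattice d → ℝ≥0∞) (c : ℝ≥0∞) (x : Lattice d) :
    nbrAvg (fun z => g z * c) x = nbrAvg g x * c := by
  simp [nbrAvg, Finset.sum_mul, mul_assoc]

theorem inv_two_mul_dim_mul [NeZero d] :
    (2 * (d : ℝ≥0∞))⁻¹ * (2 * d) = 1 := by
  have hd : (d : ℝ≥0∞) ≠ 0 := by exact_mod_cast NeZero.ne d
  exact ENNReal.inv_mul_cancel (mul_ne_zero two_ne_zero hd)
    (ENNReal.mul_ne_top ENNReal.ofNat_ne_top (ENNReal.natCast_ne_top d))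

theorem nbrAvg_const [NeZero d] (c : ℝ≥0∞) (x : Lattice d) : nbrAvg (fun _ => c) x = c := by
  simp only [nbrAvg, Finset.sum_const, Finset.card_univ, Fintype.card_prod, Fintype.card_fin,
    Fintype.card_bool, nsmul_eq_mul, Nat.cast_mul, Nat.cast_ofNat]
  rw [← mul_assoc, mul_comm (d : ℝ≥0∞) 2, inv_two_mul_dim_mul, one_mul]

theorem le_nbrAvg (g : Lattice d → ℝ≥0∞) (x : Lattice d) (s : Fin d × Bool) :
    (2 * (d : ℝ≥0∞))⁻¹ * g (x + unitStep s) ≤ nbrAvg g x :=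
  mul_le_mul_right
    (Finset.single_le_sum (f := fun s => g (x + unitStep s)) (fun _ _ => zero_le)
      (Finset.mem_univ s)) _

theorem killedStep_tsum {ι : Type*} (f : Lattice d → ℝ≥0∞) (g : ι → Lattice d → ℝ≥0∞) :
    killedStep f (fun z => ∑' i, g i z) = fun x => ∑' i, killedStep f (g i) x := by
  ext x; simp only [killedStep, nbrAvg_tsum, ENNReal.tsum_mul_left]

theorem killedStep_finsetSum {ι : Type*} (t : Finset ι) (f : Lattice d → ℝ≥0∞)
    (g : ι → Lattice d → ℝ≥0∞) :
    killedStep f (fun z => ∑ i ∈ t, g i z) = fun x => ∑ i ∈ t, killedStep f (g i) x := by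
  ext x
  simp only [killedStep, nbrAvg, Finset.mul_sum]
  exact Finset.sum_comm

theorem killedStep_add (f g g' : Lattice d → ℝ≥0∞) :
    killedStep f (g + g') = killedStep f g + killedStep f g' := by
  ext x; simp [killedStep, nbrAvg_add, mul_add]

theorem killedStep_add_left (f f' g : Lattice d → ℝ≥0∞) :
    killedStep (f + f') g = killedStep f g + killedStep f' g := by
  ext x; simp [killedStep, add_mul]

theorem killedStep_mul_const (f g : Lattice d → ℝ≥0∞) (c : ℝ≥0∞) :
    killedStep f (fun z => g z * c) = fun x => killedStep f g x * c := by
  ext x; simp [killedStep, nbrAvg_mul_const, mul_assoc]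

theorem killedStep_iterate_tsum {ι : Type*} (f : Lattice d → ℝ≥0∞) (n : ℕ)
    (g : ι → Lattice d → ℝ≥0∞) :
    (killedStep f)^[n] (fun z => ∑' i, g i z) = fun x => ∑' i, (killedStep f)^[n] (g i) x := by
  induction n with
  | zero => rfl
  | succ n ih =>
    simp only [Function.iterate_succ_apply']
    rw [ih, killedStep_tsum]

theorem killedStep_iterate_mul_const (f : Lattice d → ℝ≥0∞) (n : ℕ) (g : Lattice d → ℝ≥0∞)
    (c : ℝ≥0∞) :
    (killedStep f)^[n] (fun z => g z * c) = fun x => (killedStep f)^[n] g x * c := by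
  induction n with
  | zero => rfl
  | succ n ih =>
    simp only [Function.iterate_succ_apply']
    rw [ih, killedStep_mul_const]

theorem killedStep_iterate_mono {f f' : Lattice d → ℝ≥0∞} (hf : f ≤ f') (n : ℕ)
    {g g' : Lattice d → ℝ≥0∞} (hg : g ≤ g') :
    (killedStep f)^[n] g ≤ (killedStep f')^[n] g' := by
  induction n with
  | zero => exact hg
  | succ n ih =>
    simp only [Function.iterate_succ_apply']
    exact killedStep_mono hf ih

theorem green_mono {f f' g g' : Lattice d → ℝ≥0∞} (hf : f ≤ f') (hg : g ≤ g') :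
    green f g ≤ green f' g' :=
  fun x => ENNReal.tsum_le_tsum fun n => killedStep_iterate_mono hf n hg x

theorem green_tsum {ι : Type*} (f : Lattice d → ℝ≥0∞) (g : ι → Lattice d → ℝ≥0∞)
    (x : Lattice d) : green f (fun z => ∑' i, g i z) x = ∑' i, green f (g i) x := by
  simp only [green, killedStep_iterate_tsum]
  exact ENNReal.tsum_comm

theorem green_mul_const (f g : Lattice d → ℝ≥0∞) (c : ℝ≥0∞) (x : Lattice d) :
    green f (fun z => g z * c) x = green f g x * c := by
  simp only [green, killedStep_iterate_mul_const, ENNReal.tsum_mul_right]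

/-- The Green operator is represented by the kernel `green f (Pi.single z 1) x`. -/
theorem green_eq_tsum (f g : Lattice d → ℝ≥0∞) (x : Lattice d) :
    green f g x = ∑' z, green f (Pi.single z 1) x * g z := by
  have h : g = fun w => ∑' z, (Pi.single z 1 : Lattice d → ℝ≥0∞) w * g z := by
    ext w
    rw [tsum_eq_single w]
    · simp
    · intro z hz
      simp [hz.symm]
  conv_lhs => rw [h]
  rw [green_tsum]
  simp only [green_mul_const]

theorem green_eq_add_killedStep (f g : Lattice d → ℝ≥0∞) :
    green f g = g + killedStep f (green f g) := by
  ext x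
  have : killedStep f (green f g) x = ∑' n, (killedStep f)^[n + 1] g x := by
    have h := congrFun (killedStep_tsum f (fun n : ℕ => (killedStep f)^[n] g)) x
    simp only [Function.iterate_succ_apply']
    exact h
  rw [Pi.add_apply, this]
  exact tsum_eq_zero_add' ENNReal.summable

theorem green_eq_add_green_killedStep (f g : Lattice d → ℝ≥0∞) :
    green f g = g + green f (killedStep f g) := by
  ext x
  exact tsum_eq_zero_add' (f := fun n => (killedStep f)^[n] g x) ENNReal.summable

/-- The Green operator gives the minimal supersolution. -/
theorem green_le_of_supersolution {f g q : Lattice d → ℝ≥0∞} (h : g + killedStep f q ≤ q) :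
    green f g ≤ q := by
  have key : ∀ n : ℕ, (fun x => ∑ k ∈ Finset.range n, (killedStep f)^[k] g x) ≤ q := by
    intro n
    induction n with
    | zero => intro x; simp
    | succ n ih =>
      refine le_trans (fun x => ?_) h
      simp only [Finset.sum_range_succ', Function.iterate_zero, id_eq, Pi.add_apply]
      rw [add_comm]
      refine add_le_add le_rfl (le_trans (le_of_eq ?_) (killedStep_mono le_rfl ih x))
      rw [killedStep_finsetSum]
      simp only [Function.iterate_succ_apply']
  intro x
  rw [green, ENNReal.tsum_eq_iSup_nat]
  exact iSup_le fun n => key n x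

theorem le_green (f g : Lattice d → ℝ≥0∞) : g ≤ green f g := by
  rw [green_eq_add_killedStep]; exact le_self_add

theorem killedStep_green_le (f g : Lattice d → ℝ≥0∞) :
    killedStep f (green f g) ≤ green f g := by
  conv_rhs => rw [green_eq_add_killedStep]
  exact le_add_self

/-- In the square of the Neumann series the n-th power occurs once for each of the n + 1 splittings
k + m = n. -/
theorem tsum_mul_iterate_le_green_green (f g : Lattice d → ℝ≥0∞) (x : Lattice d) :
    ∑' n : ℕ, (n : ℝ≥0∞) * (killedStep f)^[n] g x ≤ green f (green f g) x := by
  have h : green f (green f g) x = ∑' k : ℕ, ∑' m : ℕ, (killedStep f)^[k + m] g x := by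
    rw [green]
    congr 1; ext k
    have := congrFun (killedStep_iterate_tsum f k (fun m : ℕ => (killedStep f)^[m] g)) x
    simp only [Function.iterate_add_apply]
    exact this
  rw [h, ← ENNReal.tsum_prod, ← Finset.HasAntidiagonal.sigmaAntidiagonalEquivProd.tsum_eq (fun p : ℕ × ℕ => (killedStep f)^[p.1 + p.2] g x), ENNReal.tsum_sigma']
  refine ENNReal.tsum_le_tsum fun n => ?_
  rw [tsum_fintype]
  have : ∀ b : Finset.HasAntidiagonal.antidiagonal n,
      (killedStep f)^[(Finset.HasAntidiagonal.sigmaAntidiagonalEquivProd ⟨n, b⟩).1 +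
        (Finset.HasAntidiagonal.sigmaAntidiagonalEquivProd ⟨n, b⟩).2] g x = (killedStep f)^[n] g x := by
    rintro ⟨⟨a, b⟩, hb⟩
    rw [Finset.HasAntidiagonal.mem_antidiagonal] at hb
    simp only [Finset.HasAntidiagonal.sigmaAntidiagonalEquivProd_apply]
    rw [← hb]
  simp only [this, Finset.sum_const, Finset.card_univ, nsmul_eq_mul, Fintype.card_coe,
    Finset.Nat.card_antidiagonal]
  gcongr
  simp

/-- Decomposition at the first entrance into `B`. -/
theorem green_eq_green_indicator {f g : Lattice d → ℝ≥0∞} {B : Set (Lattice d)}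
    (hg : ∀ z ∉ B, g z = 0) :
    green f g ≤ green (Bᶜ.indicator f) (B.indicator (green f g)) := by
  set q := green (Bᶜ.indicator f) (B.indicator (green f g)) with hq
  -- The reverse inequality is needed first: on B, q agrees with `green f g`, and the one-step
  -- average of q must not exceed that of `green f g`.
  have hle : q ≤ green f g := by
    refine green_le_of_supersolution fun z => ?_
    by_cases hz : z ∈ B
    · simp [hz, killedStep]
    · have := killedStep_green_le f g z
      simpa [hz, killedStep] using this
  refine green_le_of_supersolution fun z => ?_
  by_cases hz : z ∈ B
  · have h1 : q z = green f g z := by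
      rw [hq, green_eq_add_killedStep]
      simp [hz, killedStep]
    rw [h1]
    conv_rhs => rw [green_eq_add_killedStep]
    exact add_le_add le_rfl (killedStep_mono le_rfl hle z)
  · conv_rhs => rw [hq, green_eq_add_killedStep]
    simp [hz, hg z hz, killedStep, ← hq]

/-- Decomposition at the last visit to `B`. -/
theorem green_le_green_indicator_add {f g : Lattice d → ℝ≥0∞} (B : Set (Lattice d)) :
    green f g ≤ green (Bᶜ.indicator f) g +
      green f (killedStep (B.indicator f) (green (Bᶜ.indicator f) g)) := by
  set k := green (Bᶜ.indicator f) g with hk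
  set r := killedStep (B.indicator f) k with hr
  -- The right-hand side solves the Poisson equation exactly: add the equations for k and for `green
  -- f r`, splitting f into its parts on and off B.
  refine green_le_of_supersolution (le_of_eq ?_)
  have h1 : killedStep f k = r + killedStep (Bᶜ.indicator f) k := by
    rw [hr, ← killedStep_add_left, Set.indicator_self_add_compl]
  have h2 : k = g + killedStep (Bᶜ.indicator f) k := green_eq_add_killedStep _ _
  have h3 : green f r = r + killedStep f (green f r) := green_eq_add_killedStep _ _
  rw [killedStep_add, h1]
  conv_rhs => rw [h2, h3]
  abel

/-- A lower bound for superharmonic functions. -/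
theorem green_single_mul_le {f q : Lattice d → ℝ≥0∞} {v : Lattice d} (hv : f v = 0)
    (hq : killedStep f q ≤ q) (u : Lattice d) : green f (Pi.single v 1) u * q v ≤ q u := by
  -- Since f vanishes at v, the killed step drops out there, and q is a supersolution for the source
  -- of mass q v at v.
  rw [← green_mul_const]
  refine green_le_of_supersolution (fun z => ?_) u
  by_cases hz : z = v
  · subst hz; simp [killedStep, hv]
  · simpa [Pi.single_apply, hz] using hq z

/-- Each visit to t is survived with weight at most ρ, so the visits are dominated by a geometric
series; in operator form, a constant is a supersolution. -/
theorem green_single_le_of_trap [NeZero d] {f : Lattice d → ℝ≥0∞} (hf : ∀ z, f z ≤ 1)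
    {t : Lattice d} {ρ : ℝ≥0∞} (hρ : ρ < 1) (ht : f t ≤ ρ) (u : Lattice d) :
    green f (Pi.single t 1) u ≤ (1 - ρ)⁻¹ := by
  have h0 : 1 - ρ ≠ 0 := (tsub_pos_of_lt hρ).ne'
  have h1 : 1 - ρ ≠ ⊤ := ne_top_of_le_ne_top ENNReal.one_ne_top tsub_le_self
  have h2 : 1 + ρ * (1 - ρ)⁻¹ = (1 - ρ)⁻¹ := by
    nth_rewrite 1 [← ENNReal.mul_inv_cancel h0 h1]
    rw [← add_mul, tsub_add_cancel_of_le hρ.le, one_mul]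
  refine green_le_of_supersolution (q := fun _ => (1 - ρ)⁻¹) (fun z => ?_) u
  simp only [Pi.add_apply, killedStep, nbrAvg_const]
  by_cases hz : z = t
  · subst hz
    simp only [Pi.single_eq_same]
    conv_rhs => rw [← h2]
    gcongr
  · simp only [Pi.single_apply, hz, if_false, zero_add]
    exact mul_le_of_le_one_left zero_le (hf z)

/-- Every visit to v can be continued by surviving there and jumping to the chosen neighbour, so the
pole moves one step at the price of one survival weight and one jump probability. -/
theorem green_single_mul_le_of_nbr (f : Lattice d → ℝ≥0∞) (u v : Lattice d)
    (s : Fin d × Bool) :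
    green f (Pi.single v 1) u * (f v * (2 * (d : ℝ≥0∞))⁻¹) ≤
      green f (Pi.single (v + unitStep s) 1) u := by
  rw [← green_mul_const]
  conv_rhs => rw [green_eq_add_green_killedStep]
  refine le_trans (green_mono le_rfl (fun z => ?_) u) le_add_self
  by_cases hz : z = v
  · subst hz
    simp only [Pi.single_eq_same, one_mul, killedStep]
    gcongr
    have := le_nbrAvg (Pi.single (z + unitStep s) 1) z s
    simpa using this
  · simp [hz]

/-! ### The Markov property and the weights of hitting paths. -/

/-- Prepend a value to a sequence. -/
def consSeq {α : Type*} (a : α) (s : ℕ → α) : ℕ → α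
  | 0 => a
  | n + 1 => s n

@[simp] theorem consSeq_zero {α : Type*} (a : α) (s : ℕ → α) : consSeq a s 0 = a := rfl

@[simp] theorem consSeq_succ {α : Type*} (a : α) (s : ℕ → α) (n : ℕ) :
    consSeq a s (n + 1) = s n := rfl

theorem measurable_consSeq {α : Type*} [MeasurableSpace α] :
    Measurable (fun p : α × (ℕ → α) => consSeq p.1 p.2) := by
  refine measurable_pi_iff.2 fun n => ?_
  cases n with
  | zero => exact measurable_fst
  | succ n => exact (measurable_pi_apply n).comp measurable_snd

/-- Splitting off the first coordinate of an i.i.d. sequence, on which the Markov property at time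
one rests. -/
theorem infinitePi_eq_map_consSeq {α : Type*} [MeasurableSpace α] (ν : Measure α)
    [IsProbabilityMeasure ν] :
    (Measure.infinitePi fun _ : ℕ => ν) =
      (ν.prod (Measure.infinitePi fun _ : ℕ => ν)).map (fun p => consSeq p.1 p.2) := by
  refine (Measure.eq_infinitePi _ fun s t ht => ?_).symm
  classical
  -- Free coordinates are filled with `Set.univ`, so that the cylinder is indexed by an initial
  -- segment and can be shifted.
  set t' : ℕ → Set α := fun n => if n ∈ s then t n else Set.univ with ht'
  have hm : ∀ n, MeasurableSet (t' n) := fun n => by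
    rw [ht']; dsimp only; split_ifs
    · exact ht n
    · exact MeasurableSet.univ
  obtain ⟨N, hN⟩ : ∃ N, s ⊆ Finset.range (N + 1) :=
    ⟨s.sup id, fun n hn => Finset.mem_range.2 (Nat.lt_succ_of_le (Finset.le_sup (f := id) hn))⟩
  have hset : (fun p : α × (ℕ → α) => consSeq p.1 p.2) ⁻¹' (Set.pi s t) =
      t' 0 ×ˢ Set.pi (Finset.range N) (fun n => t' (n + 1)) := by
    ext ⟨a, ξ⟩
    simp only [Set.mem_preimage, Set.mem_pi, Set.mem_prod, Finset.mem_coe, ht']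
    constructor
    · intro h
      refine ⟨?_, fun n _ => ?_⟩
      · split_ifs with h0
        · exact h 0 h0
        · trivial
      · split_ifs with h0
        · exact h (n + 1) h0
        · trivial
    · rintro ⟨h0, h1⟩ n hn
      cases n with
      | zero => simpa [hn] using h0
      | succ n =>
        have := h1 n (by have := hN hn; simp at this ⊢; omega)
        simpa [hn] using this
  rw [Measure.map_apply measurable_consSeq (MeasurableSet.pi s.countable_toSet fun n _ => ht n),
    hset, Measure.prod_prod, Measure.infinitePi_pi _ (fun n _ => hm (n + 1))]
  have h1 : ∏ i ∈ s, ν (t i) = ∏ i ∈ Finset.range (N + 1), ν (t' i) := by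
    rw [← Finset.prod_subset hN (f := fun i => ν (t' i))]
    · exact Finset.prod_congr rfl fun i hi => by simp [ht', hi]
    · intro i _ hi
      simp [ht', hi]
  rw [h1, Finset.prod_range_succ', mul_comm]

theorem lintegral_stepLaw (g : Lattice d → ℝ≥0∞) (x : Lattice d) :
    ∫⁻ e, g (x + e) ∂(stepLaw d) = nbrAvg g x := by
  have hm : ∀ g : Lattice d → ℝ≥0∞, Measurable g := fun g => measurable_of_countable g
  simp only [stepLaw, lintegral_smul_measure, lintegral_finsetSum_measure, lintegral_add_measure,
    lintegral_dirac' _ (hm _), nbrAvg, smul_eq_mul]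
  rw [Fintype.sum_prod_type]
  simp [unitStep]

/-- The Markov property at time one. -/
theorem lintegral_walkLaw [NeZero d] {F : Path d → ℝ≥0∞} (hF : Measurable F) (x : Lattice d) :
    ∫⁻ S, F S ∂(walkLaw x) = nbrAvg (fun z => ∫⁻ S, F (consSeq x S) ∂(walkLaw z)) x := by
  have hm : ∀ x : Lattice d, Measurable
      (fun (ξ : ℕ → Lattice d) (n : ℕ) => x + ∑ k ∈ Finset.range n, ξ k) := fun x => by fun_prop
  have hc : ∀ x : Lattice d, Measurable (fun S : Path d => consSeq x S) := fun x =>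
    measurable_consSeq.comp (measurable_const.prodMk measurable_id)
  have h1 : ∀ e : Lattice d, ∫⁻ S, F (consSeq x S) ∂(walkLaw (x + e)) =
      ∫⁻ ξ, F (fun n => x + ∑ k ∈ Finset.range n, consSeq e ξ k)
        ∂(Measure.infinitePi fun _ : ℕ => stepLaw d) := by
    intro e
    rw [walkLaw, lintegral_map (f := fun S => F (consSeq x S)) (hF.comp (hc x)) (hm _)]
    congr 1; ext ξ
    congr 1; ext1 n
    cases n with
    | zero => simp
    | succ n => rw [Finset.sum_range_succ']; simp only [consSeq_succ, consSeq_zero]; abel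
  rw [← lintegral_stepLaw]
  simp only [h1]
  have h2 : ∫⁻ S, F S ∂(walkLaw x) = ∫⁻ ξ, F (fun n => x + ∑ k ∈ Finset.range n, ξ k)
      ∂((stepLaw d).prod (Measure.infinitePi fun _ : ℕ => stepLaw d)).map
        (fun p => consSeq p.1 p.2) := by
    rw [← infinitePi_eq_map_consSeq, walkLaw, lintegral_map hF (hm x)]
  rw [h2, lintegral_map (f := fun ξ : ℕ → Lattice d => F (fun n => x + ∑ k ∈ Finset.range n, ξ k))
    (hF.comp (hm x)) measurable_consSeq, lintegral_prod]
  exact ((hF.comp (hm x)).comp measurable_consSeq).aemeasurable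

theorem hitTime_consSeq_eq_succ_iff (x y : Lattice d) (S : Path d) (n : ℕ) :
    hitTime y (consSeq x S) = ((n + 1 : ℕ) : ℕ∞) ↔ x ≠ y ∧ hitTime y S = n := by
  rw [hitTime_eq_coe_iff, hitTime_eq_coe_iff]
  constructor
  · rintro ⟨h1, h2⟩
    exact ⟨h2 0 (by omega), h1, fun m hm => h2 (m + 1) (by omega)⟩
  · rintro ⟨h0, h1, h2⟩
    refine ⟨h1, fun m hm => ?_⟩
    cases m with
    | zero => exact h0
    | succ m => exact h2 m (by omega)

theorem hitTime_consSeq_eq_zero_iff (x y : Lattice d) (S : Path d) :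
    hitTime y (consSeq x S) = ((0 : ℕ) : ℕ∞) ↔ x = y := by
  rw [hitTime_eq_coe_iff]; simp

/-- The product of the survival weights `f` along the path up to time `n`, on `τ_y = n`. -/
def hitWeight (f : Lattice d → ℝ≥0∞) (y : Lattice d) (n : ℕ) (S : Path d) : ℝ≥0∞ :=
  if hitTime y S = n then ∏ k ∈ Finset.range n, f (S k) else 0

/-- The part of `hitWeight` carried by the paths that visit `u` no later than at time `n`. -/
def visitWeight (f : Lattice d → ℝ≥0∞) (y u : Lattice d) (n : ℕ) (S : Path d) : ℝ≥0∞ :=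
  if ∃ k ≤ n, S k = u then hitWeight f y n S else 0

theorem hitWeight_consSeq_zero (f : Lattice d → ℝ≥0∞) (x y : Lattice d) (S : Path d) :
    hitWeight f y 0 (consSeq x S) = (Pi.single y 1 : Lattice d → ℝ≥0∞) x := by
  simp only [hitWeight, hitTime_consSeq_eq_zero_iff]
  simp [Pi.single_apply]

theorem hitWeight_consSeq_succ (f : Lattice d → ℝ≥0∞) (x y : Lattice d) (n : ℕ) (S : Path d) :
    hitWeight f y (n + 1) (consSeq x S) = ({y}ᶜ : Set (Lattice d)).indicator f x *
      hitWeight f y n S := by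
  simp only [hitWeight, hitTime_consSeq_eq_succ_iff]
  by_cases hx : x = y
  · simp [hx]
  · by_cases hn : hitTime y S = n
    · simp only [ne_eq, hx, not_false_eq_true, hn, and_self, if_true, Finset.prod_range_succ',
        consSeq_zero, consSeq_succ]
      simp [hx, mul_comm]
    · simp [hn]

theorem visitWeight_consSeq_self (f : Lattice d → ℝ≥0∞) (x y : Lattice d) (n : ℕ) (S : Path d) :
    visitWeight f y x n (consSeq x S) = hitWeight f y n (consSeq x S) :=
  if_pos ⟨0, Nat.zero_le n, rfl⟩

theorem visitWeight_consSeq_succ (f : Lattice d → ℝ≥0∞) {x u : Lattice d} (hx : x ≠ u)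
    (y : Lattice d) (n : ℕ) (S : Path d) :
    visitWeight f y u (n + 1) (consSeq x S) = ({y}ᶜ : Set (Lattice d)).indicator f x *
      visitWeight f y u n S := by
  have h : (∃ k ≤ n + 1, consSeq x S k = u) ↔ ∃ k ≤ n, S k = u := by
    constructor
    · rintro ⟨k, hk, hk'⟩
      cases k with
      | zero => exact absurd hk' hx
      | succ k => exact ⟨k, by omega, hk'⟩
    · rintro ⟨k, hk, hk'⟩
      exact ⟨k + 1, by omega, hk'⟩
  simp only [visitWeight, h, hitWeight_consSeq_succ]
  split_ifs <;> simp

section Measurability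
variable {Ω : Type*} {mΩ : MeasurableSpace Ω}

theorem measurable_hitWeight {f : Lattice d → Ω → ℝ≥0∞} (hf : ∀ z, Measurable (f z))
    (y : Lattice d) (n : ℕ) :
    Measurable (fun p : Ω × Path d => hitWeight (fun z => f z p.1) y n p.2) := by
  have hfj : Measurable (fun q : Lattice d × Ω => f q.1 q.2) :=
    measurable_from_prod_countable_right hf
  refine Measurable.ite (((measurable_hitTime y).comp measurable_snd)
    (measurableSet_singleton _)) (Finset.measurable_fun_prod _ fun k _ => ?_) measurable_const
  have hk : Measurable (fun p : Ω × Path d => p.2 k) :=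
    (measurable_pi_apply k).comp measurable_snd
  exact hfj.comp (hk.prodMk measurable_fst)

theorem measurable_visitWeight {f : Lattice d → Ω → ℝ≥0∞} (hf : ∀ z, Measurable (f z))
    (y u : Lattice d) (n : ℕ) :
    Measurable (fun p : Ω × Path d => visitWeight (fun z => f z p.1) y u n p.2) := by
  refine Measurable.ite ?_ (measurable_hitWeight hf y n) measurable_const
  have : {p : Ω × Path d | ∃ k ≤ n, p.2 k = u} =
      ⋃ k ∈ Finset.range (n + 1), (fun p : Ω × Path d => p.2 k) ⁻¹' {u} := by
    ext p; simp
  rw [this]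
  refine Finset.measurableSet_biUnion _ fun k _ => ?_
  exact ((measurable_pi_apply k).comp measurable_snd) (measurableSet_singleton _)

end Measurability

theorem measurable_hitWeight_right (f : Lattice d → ℝ≥0∞) (y : Lattice d) (n : ℕ) :
    Measurable (hitWeight f y n) :=
  (measurable_hitWeight (Ω := Unit) (f := fun z _ => f z) (fun _ => measurable_const) y n).comp
    (measurable_const.prodMk measurable_id : Measurable fun S : Path d => (Unit.unit, S))

theorem measurable_visitWeight_right (f : Lattice d → ℝ≥0∞) (y u : Lattice d) (n : ℕ) :
    Measurable (visitWeight f y u n) :=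
  (measurable_visitWeight (Ω := Unit) (f := fun z _ => f z) (fun _ => measurable_const) y u n).comp
    (measurable_const.prodMk measurable_id : Measurable fun S : Path d => (Unit.unit, S))

/-- Links the path measure to the operators: setting the survival weight to zero at y makes the
iterates see only first arrivals at y. -/
theorem lintegral_hitWeight [NeZero d] (f : Lattice d → ℝ≥0∞) (y : Lattice d) (n : ℕ)
    (x : Lattice d) :
    ∫⁻ S, hitWeight f y n S ∂(walkLaw x) =
      (killedStep (({y}ᶜ : Set (Lattice d)).indicator f))^[n] (Pi.single y 1) x := by
  induction n generalizing x with
  | zero =>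
    rw [lintegral_walkLaw (measurable_hitWeight_right f y 0)]
    simp only [hitWeight_consSeq_zero, lintegral_const, measure_univ, mul_one, nbrAvg_const]
    rfl
  | succ n ih =>
    rw [lintegral_walkLaw (measurable_hitWeight_right f y _), Function.iterate_succ_apply']
    simp only [hitWeight_consSeq_succ]
    simp only [lintegral_const_mul _ (measurable_hitWeight_right f y n), ih, mul_comm _
      ((killedStep _)^[n] _ _), nbrAvg_mul_const, killedStep]
    rw [mul_comm]

/-- As a function of the starting point the right-hand side is a supersolution: at u every hitting
path visits u, and elsewhere the Markov property applies. Through this bound, summing over u counts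
the distinct sites of a path. -/
theorem green_mul_green_le_tsum_visitWeight [NeZero d] (f : Lattice d → ℝ≥0∞)
    (y u x : Lattice d) :
    green (({u}ᶜ : Set (Lattice d)).indicator (({y}ᶜ : Set (Lattice d)).indicator f))
        (Pi.single u 1) x *
      green (({y}ᶜ : Set (Lattice d)).indicator f) (Pi.single y 1) u ≤
      ∑' n, ∫⁻ S, visitWeight f y u n S ∂(walkLaw x) := by
  set fy := ({y}ᶜ : Set (Lattice d)).indicator f with hfy
  rw [← green_mul_const]
  refine green_le_of_supersolution (q := fun x => ∑' n, ∫⁻ S, visitWeight f y u n S ∂(walkLaw x))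
    (fun z => ?_) x
  by_cases hz : z = u
  · subst hz
    simp only [Pi.add_apply, Pi.single_eq_same, one_mul, killedStep, Set.mem_compl_iff,
      Set.mem_singleton_iff, not_true_eq_false, not_false_eq_true, Set.indicator_of_notMem,
      zero_mul, add_zero, green]
    refine ENNReal.tsum_le_tsum fun n => le_of_eq ?_
    rw [← lintegral_hitWeight, lintegral_walkLaw (measurable_hitWeight_right f y n),
      lintegral_walkLaw (measurable_visitWeight_right f y z n)]
    simp only [visitWeight_consSeq_self]
  · have h1 : ({u}ᶜ : Set (Lattice d)).indicator fy z = fy z := by simp [hz]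
    simp only [Pi.add_apply, Pi.single_apply, hz, if_false, zero_mul, zero_add, killedStep, h1]
    rw [nbrAvg_tsum, ← ENNReal.tsum_mul_left]
    refine le_trans (ENNReal.tsum_le_tsum fun n => ?_)
      (ENNReal.tsum_comp_le_tsum_of_injective (add_left_injective 1) _)
    rw [lintegral_walkLaw (measurable_visitWeight_right f y u (n + 1))]
    simp only [visitWeight_consSeq_succ f hz,
      lintegral_const_mul _ (measurable_visitWeight_right f y u n)]
    simp only [hfy, mul_comm (Set.indicator _ f z), nbrAvg_mul_const, le_refl]

/-! ### Partition functions and hitting times as Green functions. -/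

/-- The survival weight `exp (-v z)` of one visit to `z`. -/
def survival (v : Lattice d → ℝ≥0∞) (z : Lattice d) : ℝ≥0∞ := EReal.exp (-(v z : EReal))

theorem exp_neg_sum (v : ℕ → ℝ≥0∞) (n : ℕ) :
    EReal.exp (-((∑ k ∈ Finset.range n, v k : ℝ≥0∞) : EReal)) =
      ∏ k ∈ Finset.range n, EReal.exp (-(v k : EReal)) := by
  induction n with
  | zero => simp
  | succ n ih =>
    rw [Finset.sum_range_succ, Finset.prod_range_succ, ← ih, ← EReal.exp_add, EReal.coe_ennreal_add,
      EReal.neg_add (Or.inl (EReal.coe_ennreal_ne_bot _)) (Or.inr (EReal.coe_ennreal_ne_bot _)),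
      sub_eq_add_neg]

/-- The function c is general so that c = 1 yields the partition function and c = id the expected
hitting time. -/
theorem hitTime_mul_weight (c : ℕ∞ → ℝ≥0∞) (v : Lattice d → ℝ≥0∞) (y : Lattice d) (S : Path d) :
    c (hitTime y S) * weight v y S = ∑' n : ℕ, c n * hitWeight (survival v) y n S := by
  by_cases h : hitTime y S = ⊤
  · simp [weight, hitWeight, h]
  · obtain ⟨m, hm⟩ : ∃ m : ℕ, hitTime y S = m := ⟨_, (ENat.natCast_toNat h).symm⟩
    rw [tsum_eq_single m]
    · simp [weight, hitWeight, hm, exp_neg_sum, survival]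
    · intro n hn
      have : ¬ ((m : ℕ∞) = n) := by exact_mod_cast hn.symm
      simp [hitWeight, hm, this]

theorem weight_eq_tsum (v : Lattice d → ℝ≥0∞) (y : Lattice d) (S : Path d) :
    weight v y S = ∑' n : ℕ, hitWeight (survival v) y n S := by
  simpa using hitTime_mul_weight (fun _ => 1) v y S

theorem quenchedPartition_eq_green [NeZero d] (v : Lattice d → ℝ≥0∞) (x y : Lattice d) :
    quenchedPartition v x y =
      green (({y}ᶜ : Set (Lattice d)).indicator (survival v)) (Pi.single y 1) x := by
  simp only [quenchedPartition, weight_eq_tsum]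
  rw [lintegral_tsum fun n => (measurable_hitWeight_right _ y n).aemeasurable]
  simp only [lintegral_hitWeight]
  rfl

theorem lintegral_hitTime_mul_weight_le [NeZero d] (v : Lattice d → ℝ≥0∞) (x y : Lattice d) :
    ∫⁻ S, (hitTime y S : ℝ≥0∞) * weight v y S ∂(walkLaw x) ≤
      green (({y}ᶜ : Set (Lattice d)).indicator (survival v))
        (green (({y}ᶜ : Set (Lattice d)).indicator (survival v)) (Pi.single y 1)) x := by
  simp only [hitTime_mul_weight (fun k => (k : ℝ≥0∞)) v y]
  rw [lintegral_tsum fun n =>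
    ((measurable_hitWeight_right _ y n).const_mul _).aemeasurable]
  simp only [lintegral_const_mul _ (measurable_hitWeight_right _ y _), lintegral_hitWeight]
  simpa using tsum_mul_iterate_le_green_green (({y}ᶜ : Set (Lattice d)).indicator (survival v))
    (Pi.single y 1) x

theorem survival_le_one (v : Lattice d → ℝ≥0∞) (z : Lattice d) : survival v z ≤ 1 := by
  rw [survival, EReal.exp_le_one_iff, EReal.neg_le_zero]
  exact EReal.coe_ennreal_nonneg _

/-! ### Measurability and independence over disjoint sets of sites. -/

section Measurability
variable {Ω : Type*} {m : MeasurableSpace Ω}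

theorem measurable_nbrAvg {G : Ω → Lattice d → ℝ≥0∞} (hG : ∀ z, Measurable fun ω => G ω z)
    (x : Lattice d) : Measurable fun ω => nbrAvg (G ω) x :=
  (Finset.measurable_fun_sum _ fun s _ => hG (x + unitStep s)).const_mul _

theorem measurable_green {F G : Ω → Lattice d → ℝ≥0∞} (hF : ∀ z, Measurable fun ω => F ω z)
    (hG : ∀ z, Measurable fun ω => G ω z) (x : Lattice d) :
    Measurable fun ω => green (F ω) (G ω) x := by
  refine Measurable.tsum fun n => ?_
  induction n generalizing x with
  | zero => exact hG x
  | succ n ih =>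
    simp only [Function.iterate_succ_apply']
    exact (hF x).mul (measurable_nbrAvg ih x)

theorem measurable_indicator_apply {F : Ω → Lattice d → ℝ≥0∞} {A : Set (Lattice d)}
    (hF : ∀ z ∈ A, Measurable fun ω => F ω z) (z : Lattice d) :
    Measurable fun ω => A.indicator (F ω) z := by
  by_cases hz : z ∈ A
  · simpa [hz] using hF z hz
  · simp [hz]

end Measurability

/-- The σ-algebra generated by the field `f` on a set of sites. -/
@[reducible] def siteSigma {Ω : Type*} (f : Lattice d → Ω → ℝ≥0∞) (A : Set (Lattice d)) :
    MeasurableSpace Ω :=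
  ⨆ z ∈ A, MeasurableSpace.comap (f z) inferInstance

section SiteSigma
variable {Ω : Type*} {mΩ : MeasurableSpace Ω} {f : Lattice d → Ω → ℝ≥0∞}

theorem siteSigma_le (hf : ∀ z, Measurable (f z)) (A : Set (Lattice d)) :
    siteSigma f A ≤ mΩ :=
  iSup₂_le fun z _ => (hf z).comap_le

theorem measurable_siteSigma {A : Set (Lattice d)} {z : Lattice d} (hz : z ∈ A) :
    Measurable[siteSigma f A] (f z) :=
  measurable_iff_comap_le.2 (le_iSup₂ (f := fun z (_ : z ∈ A) =>
    MeasurableSpace.comap (f z) inferInstance) z hz)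

theorem lintegral_mul_of_disjoint {μ : Measure Ω} (hf : ∀ z, Measurable (f z))
    (hind : iIndepFun f μ) {A A' : Set (Lattice d)} (hA : Disjoint A A') {X Y : Ω → ℝ≥0∞}
    (hX : Measurable[siteSigma f A] X) (hY : Measurable[siteSigma f A'] Y) :
    ∫⁻ ω, X ω * Y ω ∂μ = (∫⁻ ω, X ω ∂μ) * ∫⁻ ω, Y ω ∂μ :=
  lintegral_mul_eq_lintegral_mul_lintegral_of_independent_measurableSpace
    (siteSigma_le hf A) (siteSigma_le hf A')
    (indep_iSup_of_disjoint (fun z => (hf z).comap_le) hind hA) hX hY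

end SiteSigma

/-! ### Entrance, exit and inner weights of a box, and resampling inside it. -/

/-- The weight, at a fixed environment, of the paths from `x` to `y` that visit `u`. -/
def throughWeight (f : Lattice d → ℝ≥0∞) (x y u : Lattice d) : ℝ≥0∞ :=
  green (({u}ᶜ : Set (Lattice d)).indicator (({y}ᶜ : Set (Lattice d)).indicator f))
      (Pi.single u 1) x *
    green (({y}ᶜ : Set (Lattice d)).indicator f) (Pi.single y 1) u

/-- The entrance weight into `B` at `u`, from `x`. -/
def entranceWeight (f : Lattice d → ℝ≥0∞) (B : Finset (Lattice d)) (x y u : Lattice d) : ℝ≥0∞ :=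
  green ((B : Set (Lattice d))ᶜ.indicator (({y}ᶜ : Set (Lattice d)).indicator f))
    (Pi.single u 1) x

/-- The weight of the paths that leave `B` from `v` and reach `y` without returning. -/
def exitWeight (f : Lattice d → ℝ≥0∞) (B : Finset (Lattice d)) (y v : Lattice d) : ℝ≥0∞ :=
  if y ∈ B then (Pi.single y 1 : Lattice d → ℝ≥0∞) v
  else nbrAvg (green ((B : Set (Lattice d))ᶜ.indicator (({y}ᶜ : Set (Lattice d)).indicator f))
    (Pi.single y 1)) v

/-- The weight of the paths from `u` to the first visit of `v` that stay in `B`. -/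
def innerWeight (f : Lattice d → ℝ≥0∞) (B : Set (Lattice d)) (u v : Lattice d) : ℝ≥0∞ :=
  green ((B \ {v}).indicator f) (Pi.single v 1) u

theorem sum_mul_of_green_le {f g : Lattice d → ℝ≥0∞} {K : ℝ≥0∞} {B : Finset (Lattice d)}
    (x : Lattice d) (hK : ∀ v ∈ B, green f (Pi.single v 1) x ≤ K) (hg : ∀ z ∉ B, g z = 0) :
    green f g x ≤ K * ∑ v ∈ B, g v := by
  rw [green_eq_tsum, tsum_eq_sum (s := B) fun z hz => by simp [hg z hz], Finset.mul_sum]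
  exact Finset.sum_le_sum fun v hv => mul_le_mul' (hK v hv) le_rfl

/-- A path to x must enter B. Up to its first entrance u the environment in B is not used, and from
u on the Green function with pole x is at most K. -/
theorem green_single_le_entrance {f : Lattice d → ℝ≥0∞} {B : Finset (Lattice d)}
    {K : ℝ≥0∞} (o x y : Lattice d) (hx : x ∈ B)
    (hK : ∀ u, green f (Pi.single x 1) u ≤ K) :
    green (({y}ᶜ : Set (Lattice d)).indicator f) (Pi.single x 1) o ≤
      K * ∑ u ∈ B, entranceWeight f B o y u := by
  set fy := ({y}ᶜ : Set (Lattice d)).indicator f with hfy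
  have hfle : fy ≤ f := Set.indicator_le_self _ _
  have h1 := green_eq_green_indicator (f := fy) (g := Pi.single x 1) (B := (B : Set (Lattice d)))
    (fun z hz => by
      have : z ≠ x := fun h => hz (h ▸ hx)
      simp [this]) o
  refine h1.trans ?_
  rw [green_eq_tsum, tsum_eq_sum (s := B) fun z hz => by simp [hz], Finset.mul_sum]
  refine Finset.sum_le_sum fun u hu => ?_
  rw [mul_comm]
  refine mul_le_mul' ?_ le_rfl
  simp only [Finset.mem_coe, hu, Set.indicator_of_mem]
  exact (green_mono hfle le_rfl u).trans (hK u)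

/-- Decompose at the last departure from B, at v: the visits to v contribute at most K, the survival
weight at v is bounded by one, and what remains sees only the environment off B. If y lies in B, the
path ends in B and v = y. -/
theorem green_single_le_exit {f : Lattice d → ℝ≥0∞} (hf : ∀ z, f z ≤ 1)
    {B : Finset (Lattice d)} {K : ℝ≥0∞} (x y : Lattice d) (hx : x ∈ B)
    (hK : ∀ v ∈ B, green f (Pi.single v 1) x ≤ K) :
    green (({y}ᶜ : Set (Lattice d)).indicator f) (Pi.single y 1) x ≤
      K * ∑ v ∈ B, exitWeight f B y v := by
  set fy := ({y}ᶜ : Set (Lattice d)).indicator f with hfy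
  have hfle : fy ≤ f := Set.indicator_le_self _ _
  have hK' : ∀ v ∈ B, green fy (Pi.single v 1) x ≤ K := fun v hv =>
    (green_mono hfle le_rfl x).trans (hK v hv)
  by_cases hy : y ∈ B
  · have : ∑ v ∈ B, exitWeight f B y v = 1 := by
      simp [exitWeight, hy]
    rw [this, mul_one]
    exact hK' y hy
  · have hxy : x ≠ y := fun h => hy (h ▸ hx)
    refine (green_le_green_indicator_add (B : Set (Lattice d)) x).trans ?_
    have h0 : green ((B : Set (Lattice d))ᶜ.indicator fy) (Pi.single y 1) x = 0 := by
      rw [green_eq_add_killedStep]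
      simp [hxy, killedStep, hx]
    rw [Pi.add_apply, h0, zero_add]
    refine (sum_mul_of_green_le x hK' fun z hz => ?_).trans ?_
    · simp [killedStep, hz]
    · gcongr with v hv
      simp only [killedStep, Finset.mem_coe, hv, Set.indicator_of_mem, exitWeight, hy, if_false]
      exact mul_le_of_le_one_left zero_le ((hfle v).trans (hf v))

/-- Concatenation: entering B at u, running inside B to the first arrival at v, and leaving for y
without return gives a path through u. The factor f v pays for the departure from v. -/
theorem entrance_mul_inner_mul_exit_le {f : Lattice d → ℝ≥0∞} (hf : ∀ z, f z ≤ 1)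
    {B : Finset (Lattice d)} (o y : Lattice d) {u v : Lattice d} (hu : u ∈ B) (hv : v ∈ B) :
    entranceWeight f B o y u * exitWeight f B y v * (innerWeight f B u v * f v) ≤
      throughWeight f o y u := by
  set fy := ({y}ᶜ : Set (Lattice d)).indicator f with hfy
  set h := green fy (Pi.single y 1) with hh
  -- If y lies in B, only v = y carries exit weight. Discarding the other v ensures that the inner
  -- path does not meet y before v.
  by_cases hyv : y ∈ B ∧ v ≠ y
  · have : exitWeight f B y v = 0 := by simp [exitWeight, hyv.1, hyv.2]
    simp [this]
  have hD : innerWeight f B u v * h v ≤ h u := by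
    refine green_single_mul_le (by simp) (le_trans (killedStep_mono (fun z => ?_) le_rfl)
      (killedStep_green_le fy (Pi.single y 1))) u
    refine Set.indicator_le_indicator_of_subset (fun z hz => ?_) (fun _ => bot_le) z
    simp only [Set.mem_sdiff, Finset.mem_coe, Set.mem_singleton_iff] at hz
    simp only [Set.mem_compl_iff, Set.mem_singleton_iff]
    rintro rfl
    exact hyv ⟨hz.1, fun h => hz.2 h.symm⟩
  have he : exitWeight f B y v * f v ≤ h v := by
    by_cases hy : y ∈ B
    · have hvy : v = y := by by_contra h'; exact hyv ⟨hy, h'⟩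
      subst hvy
      have := le_green fy (Pi.single v 1) v
      simp only [Pi.single_eq_same] at this
      simp only [exitWeight, hy, if_true, Pi.single_eq_same, one_mul]
      exact (hf v).trans this
    · have hvy : v ≠ y := fun h' => hy (h' ▸ hv)
      have h1 := killedStep_green_le fy (Pi.single y 1) v
      refine le_trans ?_ h1
      simp only [killedStep, exitWeight, hy, if_false]
      rw [mul_comm]
      refine mul_le_mul' (le_of_eq (by simp [hfy, hvy])) (nbrAvg_mono (green_mono ?_ le_rfl) v)
      exact Set.indicator_le_self _ _
  have hH : entranceWeight f B o y u ≤
      green (({u}ᶜ : Set (Lattice d)).indicator fy) (Pi.single u 1) o := by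
    refine green_mono (fun z => ?_) le_rfl o
    refine Set.indicator_le_indicator_of_subset (fun z hz => ?_) (fun _ => bot_le) z
    simp only [Set.mem_compl_iff, Set.mem_singleton_iff]
    rintro rfl
    exact hz hu
  calc entranceWeight f B o y u * exitWeight f B y v * (innerWeight f B u v * f v)
      = entranceWeight f B o y u * (innerWeight f B u v * (exitWeight f B y v * f v)) := by ring
    _ ≤ green (({u}ᶜ : Set (Lattice d)).indicator fy) (Pi.single u 1) o *
        (innerWeight f B u v * h v) := by gcongr
    _ ≤ _ := by rw [throughWeight]; gcongr

/-- Neither factor reads the environment in B, which is what permits resampling there. -/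
theorem measurable_entrance_mul_exit {Ω : Type*} {f : Lattice d → Ω → ℝ≥0∞}
    (B : Finset (Lattice d)) (o y u v : Lattice d) :
    Measurable[siteSigma f ((B : Set (Lattice d))ᶜ)] fun ω =>
      entranceWeight (fun z => f z ω) B o y u * exitWeight (fun z => f z ω) B y v := by
  let m : MeasurableSpace Ω := siteSigma f ((B : Set (Lattice d))ᶜ)
  have hF : ∀ z, Measurable[m] fun ω =>
      (B : Set (Lattice d))ᶜ.indicator (({y}ᶜ : Set (Lattice d)).indicator fun z => f z ω) z := by
    refine measurable_indicator_apply (m := m) fun z hz => ?_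
    by_cases hzy : z = y
    · simp [hzy]
    · simpa [hzy] using measurable_siteSigma (f := f) hz
  have hG : ∀ x, Measurable[m] fun ω => green ((B : Set (Lattice d))ᶜ.indicator
      (({y}ᶜ : Set (Lattice d)).indicator fun z => f z ω)) (Pi.single x 1) o :=
    fun x => measurable_green (m := m) hF (G := fun _ => Pi.single x 1)
      (fun _ => measurable_const) o
  have hG' : Measurable[m] fun ω => exitWeight (fun z => f z ω) B y v := by
    unfold exitWeight
    split_ifs
    · exact measurable_const
    · exact measurable_nbrAvg (m := m) (fun z => measurable_green (m := m) hF
        (G := fun _ => Pi.single y 1) (fun _ => measurable_const) z) v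
  exact (hG u).mul hG'

theorem measurable_innerWeight {Ω : Type*} {f : Lattice d → Ω → ℝ≥0∞} (B : Set (Lattice d))
    (u v : Lattice d) :
    Measurable[siteSigma f (B \ {v})] fun ω => innerWeight (fun z => f z ω) B u v :=
  measurable_green (m := siteSigma f (B \ {v}))
    (fun z => measurable_indicator_apply (m := siteSigma f (B \ {v}))
      (fun _ hw => measurable_siteSigma hw) z)
    (G := fun _ => Pi.single v 1) (fun _ => measurable_const) u

section Environment
variable {Ω : Type*} [MeasurableSpace Ω] {μ : Measure Ω} {f : Lattice d → Ω → ℝ≥0∞}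

/-- Two independences: the weights off B against everything in B, and, within B, the inner weight
against f v, which it does not read because its paths stop at v. -/
theorem lintegral_through_ge (hf : ∀ z, Measurable (f z)) (hind : iIndepFun f μ)
    (hle : ∀ z ω, f z ω ≤ 1) {B : Finset (Lattice d)} (o y : Lattice d) {u v : Lattice d}
    (hu : u ∈ B) (hv : v ∈ B) :
    (∫⁻ ω, entranceWeight (fun z => f z ω) B o y u * exitWeight (fun z => f z ω) B y v ∂μ) *
      ((∫⁻ ω, innerWeight (fun z => f z ω) B u v ∂μ) * ∫⁻ ω, f v ω ∂μ) ≤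
      ∫⁻ ω, throughWeight (fun z => f z ω) o y u ∂μ := by
  have hsub : siteSigma f ((B : Set (Lattice d)) \ {v}) ≤ siteSigma f (B : Set (Lattice d)) :=
    biSup_mono fun z hz => hz.1
  have hDf : Measurable[siteSigma f (B : Set (Lattice d))] fun ω =>
      innerWeight (fun z => f z ω) B u v * f v ω :=
    ((measurable_innerWeight _ u v).mono hsub le_rfl).mul
      (measurable_siteSigma (Finset.mem_coe.2 hv))
  rw [← lintegral_mul_of_disjoint hf hind (A := (B : Set (Lattice d)) \ {v}) (A' := {v})
      Set.disjoint_sdiff_left (measurable_innerWeight _ u v) (measurable_siteSigma rfl),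
    ← lintegral_mul_of_disjoint hf hind (A := (B : Set (Lattice d))ᶜ) (A' := B)
      disjoint_compl_left (measurable_entrance_mul_exit B o y u v) hDf]
  exact lintegral_mono fun ω => entrance_mul_inner_mul_exit_le (fun z => hle z ω) o y hu hv

/-- Resampling the environment in a box `B` around `x` that has a trap in `B` but none in `I`. -/
theorem lintegral_box_le (hf : ∀ z, Measurable (f z)) (hind : iIndepFun f μ)
    (hle : ∀ z ω, f z ω ≤ 1) {B I : Finset (Lattice d)} (hI : I ⊆ B) {ρ K α β : ℝ≥0∞}
    (hK : ∀ ω, (∃ t ∈ B, f t ω ≤ ρ) → ∀ v ∈ B, ∀ u,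
      green (fun z => f z ω) (Pi.single v 1) u ≤ K)
    (hα : ∀ u ∈ B, ∀ v ∈ B, α ≤ ∫⁻ ω, innerWeight (fun z => f z ω) B u v ∂μ)
    (hβ : ∀ v, ∫⁻ ω, f v ω ∂μ = β) (o y : Lattice d) {x : Lattice d} (hx : x ∈ B) :
    (α * β) * ∫⁻ ω, {ω | (∀ z ∈ I, ρ < f z ω) ∧ ∃ t ∈ B, f t ω ≤ ρ}.indicator (fun ω =>
        green (({y}ᶜ : Set (Lattice d)).indicator fun z => f z ω) (Pi.single x 1) o *
          green (({y}ᶜ : Set (Lattice d)).indicator fun z => f z ω) (Pi.single y 1) x) ω ∂μ ≤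
      K ^ 2 * μ {ω | ∀ z ∈ I, ρ < f z ω} * B.card *
        ∑ u ∈ B, ∫⁻ ω, throughWeight (fun z => f z ω) o y u ∂μ := by
  set P : Set Ω := {ω | ∀ z ∈ I, ρ < f z ω} with hP
  have hPm : MeasurableSet[siteSigma f (B : Set (Lattice d))] P := by
    have : P = ⋂ z ∈ I, f z ⁻¹' Set.Ioi ρ := by ext ω; simp [hP]
    rw [this]
    exact Finset.measurableSet_biInter _ fun z hz =>
      measurable_siteSigma (Finset.mem_coe.2 (hI hz)) measurableSet_Ioi
  have hPm' : MeasurableSet P := siteSigma_le hf _ _ hPm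
  have hXY : ∀ u v, Measurable fun ω =>
      entranceWeight (fun z => f z ω) B o y u * exitWeight (fun z => f z ω) B y v := fun u v =>
    (measurable_entrance_mul_exit B o y u v).mono (siteSigma_le hf _) le_rfl
  have hPXY : ∀ u v, Measurable fun ω => P.indicator (fun _ => (1 : ℝ≥0∞)) ω *
      (entranceWeight (fun z => f z ω) B o y u * exitWeight (fun z => f z ω) B y v) := fun u v =>
    (measurable_const.indicator hPm').mul (hXY u v)
  have hindP : Measurable[siteSigma f (B : Set (Lattice d))] (P.indicator fun _ => (1 : ℝ≥0∞)) :=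
    measurable_const.indicator hPm
  -- The trap in B serves only to give the bound K and is then forgotten; the event P lives in B and
  -- is therefore independent of the entrance and exit weights.
  have hup : ∫⁻ ω, {ω | (∀ z ∈ I, ρ < f z ω) ∧ ∃ t ∈ B, f t ω ≤ ρ}.indicator (fun ω =>
        green (({y}ᶜ : Set (Lattice d)).indicator fun z => f z ω) (Pi.single x 1) o *
          green (({y}ᶜ : Set (Lattice d)).indicator fun z => f z ω) (Pi.single y 1) x) ω ∂μ ≤
      ∑ u ∈ B, ∑ v ∈ B, K ^ 2 * (μ P * ∫⁻ ω, entranceWeight (fun z => f z ω) B o y u *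
        exitWeight (fun z => f z ω) B y v ∂μ) := by
    calc _ ≤ ∫⁻ ω, ∑ u ∈ B, ∑ v ∈ B, K ^ 2 * (P.indicator (fun _ => (1 : ℝ≥0∞)) ω *
          (entranceWeight (fun z => f z ω) B o y u * exitWeight (fun z => f z ω) B y v)) ∂μ := by
          refine lintegral_mono fun ω => ?_
          refine Set.indicator_apply_le' (fun hω => ?_) (fun _ => bot_le)
          have h1 : P.indicator (fun _ => (1 : ℝ≥0∞)) ω = 1 := 
            Set.indicator_of_mem (s := P) (a := ω) hω.1 _
          simp only [h1, one_mul]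
          refine (mul_le_mul' (green_single_le_entrance o x y hx (hK ω hω.2 x hx))
            (green_single_le_exit (fun z => hle z ω) x y hx
              fun v hv => hK ω hω.2 v hv x)).trans (le_of_eq ?_)
          simp only [← Finset.mul_sum]
          rw [← Finset.sum_mul]
          ring
      _ = _ := by
          rw [lintegral_finsetSum]
          · refine Finset.sum_congr rfl fun u _ => ?_
            rw [lintegral_finsetSum]
            · refine Finset.sum_congr rfl fun v _ => ?_
              rw [lintegral_const_mul _ (hPXY u v),
                lintegral_mul_of_disjoint hf hind (A := (B : Set (Lattice d)))
                  (A' := (B : Set (Lattice d))ᶜ) disjoint_compl_right hindP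
                  (measurable_entrance_mul_exit B o y u v),
                lintegral_indicator_const hPm', one_mul]
            · exact fun v _ => (hPXY u v).const_mul _
          · exact fun u _ => Finset.measurable_fun_sum _ fun v _ =>
              (hPXY u v).const_mul _
  refine (mul_le_mul' le_rfl hup).trans ?_
  calc (α * β) * ∑ u ∈ B, ∑ v ∈ B, K ^ 2 * (μ P * ∫⁻ ω, entranceWeight (fun z => f z ω) B o y u *
        exitWeight (fun z => f z ω) B y v ∂μ)
      = ∑ u ∈ B, ∑ v ∈ B, K ^ 2 * μ P * ((∫⁻ ω, entranceWeight (fun z => f z ω) B o y u *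
        exitWeight (fun z => f z ω) B y v ∂μ) * (α * β)) := by
        simp only [Finset.mul_sum]
        refine Finset.sum_congr rfl fun u _ => Finset.sum_congr rfl fun v _ => ?_
        ring
    _ ≤ ∑ u ∈ B, ∑ v ∈ B, K ^ 2 * μ P * ∫⁻ ω, throughWeight (fun z => f z ω) o y u ∂μ := by
        -- A fresh environment in B joins u to v at cost at least αβ. The bound no longer depends on
        -- v, so the sum over v becomes the factor `B.card`.
        refine Finset.sum_le_sum fun u hu => Finset.sum_le_sum fun v hv => ?_
        refine mul_le_mul' le_rfl (le_trans ?_ (lintegral_through_ge hf hind hle o y hu hv))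
        rw [hβ]
        gcongr
        exact hα u hu v hv
    _ = _ := by
        simp only [Finset.sum_const, nsmul_eq_mul, Finset.mul_sum]
        exact Finset.sum_congr rfl fun u _ => by ring

end Environment

/-! ### The annealed number of distinct visited sites. -/

/-- Repeated visits only decrease the product. Over distinct sites the factors become independent,
so that its mean is a power of β. -/
theorem prod_range_le_prod_image {f : Lattice d → ℝ≥0∞} (hf : ∀ z, f z ≤ 1) (S : Path d)
    (n : ℕ) : ∏ k ∈ Finset.range n, f (S k) ≤ ∏ z ∈ (Finset.range n).image S, f z := by
  rw [Finset.prod_comp]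
  refine Finset.prod_le_prod' fun z hz => ?_
  refine pow_le_of_le_one zero_le (hf z) (Finset.card_ne_zero.2 ?_)
  obtain ⟨k, hk, rfl⟩ := Finset.mem_image.1 hz
  exact ⟨k, by simp [Finset.mem_range.1 hk]⟩

/-- The extra 1 is for the endpoint at time n, which counts as visited but carries no survival
weight. -/
theorem tsum_visitWeight_le (f : Lattice d → ℝ≥0∞) (y : Lattice d) (n : ℕ) (S : Path d) :
    ∑' u, visitWeight f y u n S ≤ (((Finset.range n).image S).card + 1) * hitWeight f y n S := by
  have h : ∀ u ∉ (Finset.range (n + 1)).image S, visitWeight f y u n S = 0 := by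
    intro u hu
    refine if_neg fun ⟨k, hk, hk'⟩ => hu (Finset.mem_image.2 ⟨k, by simp; omega, hk'⟩)
  rw [tsum_eq_sum h]
  refine (Finset.sum_le_card_nsmul _ _ (hitWeight f y n S) fun u _ => ?_).trans ?_
  · unfold visitWeight; split_ifs <;> simp
  · rw [nsmul_eq_mul]
    gcongr
    rw [Finset.range_add_one, Finset.image_insert]
    exact_mod_cast Finset.card_insert_le _ _

theorem natCast_mul_pow_le (β : ℝ≥0∞) (hβ : β ≤ 1) (n : ℕ) : n * β ^ n ≤ (1 - β)⁻¹ := by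
  rw [← ENNReal.tsum_geometric]
  refine le_trans ?_ (ENNReal.sum_le_tsum (Finset.range n))
  rw [← nsmul_eq_mul]
  simpa using Finset.card_nsmul_le_sum (Finset.range n) (fun k => β ^ k) (β ^ n) fun k hk =>
    pow_le_pow_of_le_one zero_le hβ (Finset.mem_range.1 hk).le

section Environment
variable {Ω : Type*} [MeasurableSpace Ω] {μ : Measure Ω} {f : Lattice d → Ω → ℝ≥0∞}

theorem lintegral_hitWeight_env_le (hf : ∀ z, Measurable (f z)) (hind : iIndepFun f μ)
    (hle : ∀ z ω, f z ω ≤ 1) {β : ℝ≥0∞} (hβ : ∀ v, ∫⁻ ω, f v ω ∂μ = β) (y : Lattice d) (n : ℕ)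
    (S : Path d) :
    ∫⁻ ω, hitWeight (fun z => f z ω) y n S ∂μ ≤
      β ^ ((Finset.range n).image S).card * hitWeight (fun _ => 1) y n S := by
  unfold hitWeight
  split_ifs with h
  · refine (lintegral_mono fun ω => prod_range_le_prod_image (fun z => hle z ω) S n).trans ?_
    rw [lintegral_prod_eq_prod_lintegral_of_indepFun _ _ hind hf]
    simp [hβ]
  · simp

/-- The annealed number of visited sites is at most `M + 1`, up to an exponentially small error. -/
theorem tsum_lintegral_throughWeight_le [NeZero d] [IsProbabilityMeasure μ]
    (hf : ∀ z, Measurable (f z))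
    (hind : iIndepFun f μ) (hle : ∀ z ω, f z ω ≤ 1) {β : ℝ≥0∞} (hβ1 : β ≤ 1)
    (hβ : ∀ v, ∫⁻ ω, f v ω ∂μ = β) (o y : Lattice d) (M : ℕ) :
    ∑' u, ∫⁻ ω, throughWeight (fun z => f z ω) o y u ∂μ ≤
      (M + 1) * (∫⁻ ω, green (({y}ᶜ : Set (Lattice d)).indicator fun z => f z ω)
        (Pi.single y 1) o ∂μ) + (1 - β)⁻¹ * β ^ M := by
  have hhm : ∀ n, Measurable fun p : Path d × Ω => hitWeight (fun z => f z p.2) y n p.1 :=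
    fun n => (measurable_hitWeight hf y n).comp measurable_swap
  have hvm : ∀ u n, Measurable fun p : Path d × Ω => visitWeight (fun z => f z p.2) y u n p.1 :=
    fun u n => (measurable_visitWeight hf y u n).comp measurable_swap
  have hh1 : ∀ n, Measurable (hitWeight (fun _ : Lattice d => 1) y n) :=
    fun n => measurable_hitWeight_right _ y n
  have hEm : ∀ n, Measurable fun S => ∫⁻ ω, hitWeight (fun z => f z ω) y n S ∂μ :=
    fun n => (hhm n).lintegral_prod_right'
  have hsum1 : ∑' n, ∫⁻ S, hitWeight (fun _ : Lattice d => 1) y n S ∂(walkLaw o) ≤ 1 := by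
    rw [← lintegral_tsum fun n => (hh1 n).aemeasurable]
    refine (lintegral_mono (g := fun _ => 1) fun S => ?_).trans (by simp)
    by_cases h : hitTime y S = ⊤
    · simp [hitWeight, h]
    · obtain ⟨m, hm⟩ : ∃ m : ℕ, hitTime y S = m := ⟨_, (ENat.natCast_toNat h).symm⟩
      rw [tsum_eq_single m]
      · simp [hitWeight, hm]
      · intro n hn
        have : ¬ ((m : ℕ∞) = n) := by exact_mod_cast hn.symm
        simp [hitWeight, hm, this]
  have hZ : ∫⁻ ω, green (({y}ᶜ : Set (Lattice d)).indicator fun z => f z ω)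
      (Pi.single y 1) o ∂μ =
      ∑' n, ∫⁻ S, ∫⁻ ω, hitWeight (fun z => f z ω) y n S ∂μ ∂(walkLaw o) := by
    simp only [green, ← lintegral_hitWeight]
    rw [lintegral_tsum fun n => ((measurable_hitWeight hf y n).lintegral_prod_right').aemeasurable]
    congr 1; ext n
    exact lintegral_lintegral_swap (measurable_hitWeight hf y n).aemeasurable
  have hpt : ∀ n S, ∑' u, ∫⁻ ω, visitWeight (fun z => f z ω) y u n S ∂μ ≤
      (M + 1) * (∫⁻ ω, hitWeight (fun z => f z ω) y n S ∂μ) +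
        (1 - β)⁻¹ * β ^ M * hitWeight (fun _ => 1) y n S := by
    intro n S
    set c := ((Finset.range n).image S).card with hc
    set W := ∫⁻ ω, hitWeight (fun z => f z ω) y n S ∂μ with hW
    have hhS : Measurable fun ω => hitWeight (fun z => f z ω) y n S :=
      (hhm n).comp (measurable_const.prodMk measurable_id)
    have hvS : ∀ u, Measurable fun ω => visitWeight (fun z => f z ω) y u n S :=
      fun u => (hvm u n).comp (measurable_const.prodMk measurable_id)
    have h1 : ∑' u, ∫⁻ ω, visitWeight (fun z => f z ω) y u n S ∂μ ≤ (c + 1) * W := by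
      rw [← lintegral_tsum fun u => (hvS u).aemeasurable, hW, ← lintegral_const_mul _ hhS]
      exact lintegral_mono fun ω => tsum_visitWeight_le _ y n S
    have hWle : W ≤ β ^ c * hitWeight (fun _ => 1) y n S :=
      lintegral_hitWeight_env_le hf hind hle hβ y n S
    clear_value c W
    refine h1.trans ?_
    -- If c = M + j, the excess j is absorbed by β ^ j through j β ^ j ≤ (1 - β)⁻¹, and β ^ M is
    -- left over.
    rcases le_total c M with hcM | hcM
    · refine le_trans (mul_le_mul' ?_ le_rfl) le_self_add
      gcongr
    · obtain ⟨j, rfl⟩ := Nat.exists_eq_add_of_le hcM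
      have : (((M + j : ℕ) : ℝ≥0∞) + 1) * W = (M + 1) * W + j * W := by push_cast; ring
      rw [this]
      refine add_le_add le_rfl ((mul_le_mul' le_rfl hWle).trans ?_)
      rw [pow_add]
      calc (j : ℝ≥0∞) * (β ^ M * β ^ j * hitWeight (fun _ => 1) y n S)
          = (j * β ^ j) * β ^ M * hitWeight (fun _ => 1) y n S := by ring
        _ ≤ _ := by
          gcongr
          exact natCast_mul_pow_le β hβ1 j
  calc ∑' u, ∫⁻ ω, throughWeight (fun z => f z ω) o y u ∂μ
      ≤ ∑' u, ∑' n, ∫⁻ S, ∫⁻ ω, visitWeight (fun z => f z ω) y u n S ∂μ ∂(walkLaw o) := by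
        refine ENNReal.tsum_le_tsum fun u => ?_
        refine (lintegral_mono fun ω => green_mul_green_le_tsum_visitWeight _ y u o).trans ?_
        rw [lintegral_tsum fun n =>
          ((measurable_visitWeight hf y u n).lintegral_prod_right').aemeasurable]
        refine ENNReal.tsum_le_tsum fun n => le_of_eq ?_
        exact lintegral_lintegral_swap (measurable_visitWeight hf y u n).aemeasurable
    _ = ∑' n, ∫⁻ S, ∑' u, ∫⁻ ω, visitWeight (fun z => f z ω) y u n S ∂μ ∂(walkLaw o) := by
        rw [ENNReal.tsum_comm]
        congr 1; ext n
        rw [lintegral_tsum fun u => ((hvm u n).lintegral_prod_right').aemeasurable]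
    _ ≤ ∑' n, ∫⁻ S, ((M + 1) * (∫⁻ ω, hitWeight (fun z => f z ω) y n S ∂μ) +
        (1 - β)⁻¹ * β ^ M * hitWeight (fun _ => 1) y n S) ∂(walkLaw o) :=
        ENNReal.tsum_le_tsum fun n => lintegral_mono fun S => hpt n S
    _ = (M + 1) * (∑' n, ∫⁻ S, ∫⁻ ω, hitWeight (fun z => f z ω) y n S ∂μ ∂(walkLaw o)) +
        (1 - β)⁻¹ * β ^ M * ∑' n, ∫⁻ S, hitWeight (fun _ => 1) y n S ∂(walkLaw o) := by
        simp only [lintegral_add_left ((hEm _).const_mul _), lintegral_const_mul _ (hEm _),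
          lintegral_const_mul _ (hh1 _)]
        rw [ENNReal.tsum_add, ENNReal.tsum_mul_left, ENNReal.tsum_mul_left]
    _ ≤ _ := by
        rw [hZ]
        exact add_le_add le_rfl (mul_le_of_le_one_right zero_le hsum1)

end Environment

/-! ### Cubes and the distance to the nearest trap. -/

/-- The cube of radius `r` around `x`, empty for `r < 0`. -/
def cube (x : Lattice d) (r : ℤ) : Finset (Lattice d) :=
  Finset.Icc (fun i => x i - r) (fun i => x i + r)

theorem mem_cube {x z : Lattice d} {r : ℤ} : z ∈ cube x r ↔ ∀ i, |z i - x i| ≤ r := by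
  simp only [cube, Finset.mem_Icc, Pi.le_def, abs_le, ← forall_and]
  refine forall_congr' fun i => ?_
  constructor <;> intro h <;> constructor <;> linarith [h.1, h.2]

theorem mem_cube_comm {x z : Lattice d} {r : ℤ} : z ∈ cube x r ↔ x ∈ cube z r := by
  simp only [mem_cube, abs_sub_comm]

theorem self_mem_cube (x : Lattice d) (R : ℕ) : x ∈ cube x R := by simp [mem_cube]

theorem card_cube (x : Lattice d) (r : ℤ) : (cube x r).card = (2 * r + 1).toNat ^ d := by
  rw [cube, Pi.card_Icc]
  simp only [Int.card_Icc]
  rw [Finset.prod_congr rfl (g := fun _ => (2 * r + 1).toNat) fun i _ => by congr 1; ring]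
  simp

theorem cube_mono (x : Lattice d) {r r' : ℤ} (h : r ≤ r') : cube x r ⊆ cube x r' :=
  fun _ hz => mem_cube.2 fun i => (mem_cube.1 hz i).trans h

theorem exists_mem_cube (x t : Lattice d) : ∃ R : ℕ, t ∈ cube x R := by
  refine ⟨∑ i, (t i - x i).natAbs, mem_cube.2 fun i => ?_⟩
  rw [Int.abs_eq_natAbs]
  exact_mod_cast Finset.single_le_sum (f := fun i => (t i - x i).natAbs)
    (fun _ _ => Nat.zero_le _) (Finset.mem_univ i)

/-- The event that the trap nearest to `x` is at distance `R`. -/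
def nearestTrap {Ω : Type*} (f : Lattice d → Ω → ℝ≥0∞) (ρ : ℝ≥0∞) (x : Lattice d) (R : ℕ) : Set Ω :=
  {ω | (∀ z ∈ cube x ((R : ℤ) - 1), ρ < f z ω) ∧ ∃ t ∈ cube x R, f t ω ≤ ρ}

theorem exists_mem_nearestTrap [NeZero d] {Ω : Type*} {f : Lattice d → Ω → ℝ≥0∞} {ρ : ℝ≥0∞} {ω : Ω} {t : Lattice d} (ht : f t ω ≤ ρ)
    (x : Lattice d) : ∃ R, ω ∈ nearestTrap f ρ x R := by
  classical
  have h : ∃ R : ℕ, ∃ t ∈ cube x R, f t ω ≤ ρ := by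
    obtain ⟨R, hR⟩ := exists_mem_cube x t
    exact ⟨R, t, hR, ht⟩
  refine ⟨Nat.find h, fun z hz => ?_, Nat.find_spec h⟩
  by_contra hlt
  -- At distance 0 there is nothing to avoid, since the cube of radius -1 is empty.
  rcases Nat.eq_zero_or_pos (Nat.find h) with h0 | h0
  · rw [h0] at hz
    have := mem_cube.1 hz 0
    have h2 := abs_nonneg (z 0 - x 0)
    simp at this; omega
  · refine Nat.find_min h (Nat.sub_lt h0 one_pos) ⟨z, ?_, not_lt.1 hlt⟩
    rwa [Nat.cast_sub (Nat.one_le_iff_ne_zero.2 h0.ne'), Nat.cast_one]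

section Environment
variable {Ω : Type*} [MeasurableSpace Ω] {μ : Measure Ω} {f : Lattice d → Ω → ℝ≥0∞}

theorem measurableSet_nearestTrap (hf : ∀ z, Measurable (f z)) (ρ : ℝ≥0∞) (x : Lattice d)
    (R : ℕ) : MeasurableSet (nearestTrap f ρ x R) := by
  have : nearestTrap f ρ x R = (⋂ z ∈ cube x ((R : ℤ) - 1), f z ⁻¹' Set.Ioi ρ) ∩
      ⋃ t ∈ cube x (R : ℤ), f t ⁻¹' Set.Iic ρ := by
    ext ω; simp [nearestTrap]
  rw [this]
  exact (Finset.measurableSet_biInter _ fun z _ => hf z measurableSet_Ioi).inter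
    (Finset.measurableSet_biUnion _ fun z _ => hf z measurableSet_Iic)

/-- Sums a box bound over all centres x and trap distances R. Each u lies in the cubes of (2R+1)^d
centres, which produces a second volume factor. -/
theorem lintegral_green_green_le [NeZero d] (hf : ∀ z, Measurable (f z)) {ρ : ℝ≥0∞}
    (htrap : ∀ᵐ ω ∂μ, ∃ t, f t ω ≤ ρ) (o y : Lattice d) (c : ℕ → ℝ≥0∞)
    (hc : ∀ x R, ∫⁻ ω, (nearestTrap f ρ x R).indicator (fun ω =>
        green (({y}ᶜ : Set (Lattice d)).indicator fun z => f z ω) (Pi.single x 1) o *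
          green (({y}ᶜ : Set (Lattice d)).indicator fun z => f z ω) (Pi.single y 1) x) ω ∂μ ≤
      c R * ∑ u ∈ cube x R, ∫⁻ ω, throughWeight (fun z => f z ω) o y u ∂μ) :
    ∫⁻ ω, green (({y}ᶜ : Set (Lattice d)).indicator fun z => f z ω)
      (green (({y}ᶜ : Set (Lattice d)).indicator fun z => f z ω) (Pi.single y 1)) o ∂μ ≤
      (∑' R : ℕ, c R * (2 * R + 1) ^ d) *
        ∑' u, ∫⁻ ω, throughWeight (fun z => f z ω) o y u ∂μ := by
  set F : Lattice d → Ω → ℝ≥0∞ := fun x ω =>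
    green (({y}ᶜ : Set (Lattice d)).indicator fun z => f z ω) (Pi.single x 1) o *
      green (({y}ᶜ : Set (Lattice d)).indicator fun z => f z ω) (Pi.single y 1) x with hF
  set t : Lattice d → ℝ≥0∞ := fun u => ∫⁻ ω, throughWeight (fun z => f z ω) o y u ∂μ with ht
  have hgm : ∀ a b, Measurable fun ω =>
      green (({y}ᶜ : Set (Lattice d)).indicator fun z => f z ω) (Pi.single a 1) b := fun a b =>
    measurable_green (G := fun _ => Pi.single a 1)
      (measurable_indicator_apply fun z _ => hf z) (fun _ => measurable_const) b
  have hFm : ∀ x, Measurable (F x) := fun x => (hgm x o).mul (hgm y x)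
  have hcover : ∀ x, ∫⁻ ω, F x ω ∂μ ≤ ∑' R, ∫⁻ ω, (nearestTrap f ρ x R).indicator (F x) ω ∂μ := by
    intro x
    rw [← lintegral_tsum fun R =>
      ((hFm x).indicator (measurableSet_nearestTrap hf ρ x R)).aemeasurable]
    refine lintegral_mono_ae ?_
    filter_upwards [htrap] with ω ⟨s, hs⟩
    obtain ⟨R, hR⟩ := exists_mem_nearestTrap hs x
    refine le_trans (le_of_eq ?_) (ENNReal.le_tsum R)
    rw [Set.indicator_of_mem hR]
  have hcount : ∀ R : ℕ, ∑' x, ∑ u ∈ cube x R, t u = (2 * R + 1) ^ d * ∑' u, t u := by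
    intro R
    have h1 : ∀ x, ∑ u ∈ cube x R, t u = ∑' u, (cube u R : Set (Lattice d)).indicator
        (fun _ => t u) x := by
      intro x
      rw [tsum_eq_sum (s := cube x R)]
      · refine Finset.sum_congr rfl fun u hu => ?_
        rw [Set.indicator_of_mem (Finset.mem_coe.2 (mem_cube_comm.1 hu))]
      · intro u hu
        rw [Set.indicator_of_notMem fun h => hu (mem_cube_comm.1 (Finset.mem_coe.1 h))]
    simp only [h1]
    rw [ENNReal.tsum_comm, ← ENNReal.tsum_mul_left]
    congr 1; ext u
    rw [tsum_eq_sum (s := cube u R) fun z hz => Set.indicator_of_notMem (by simpa using hz) _,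
      Finset.sum_congr rfl (g := fun _ => t u) fun z hz =>
        Set.indicator_of_mem (Finset.mem_coe.2 hz) _, Finset.sum_const, card_cube, nsmul_eq_mul]
    congr 1
    have : (2 * (R : ℤ) + 1).toNat = 2 * R + 1 := by omega
    rw [this]; push_cast; rfl
  calc _ = ∑' x, ∫⁻ ω, F x ω ∂μ := by
        rw [← lintegral_tsum fun x => (hFm x).aemeasurable]
        congr 1; ext ω
        rw [green_eq_tsum]
    _ ≤ ∑' x, ∑' R : ℕ, c R * ∑ u ∈ cube x R, t u :=
        ENNReal.tsum_le_tsum fun x => (hcover x).trans (ENNReal.tsum_le_tsum fun R => hc x R)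
    _ = ∑' R : ℕ, c R * ∑' x, ∑ u ∈ cube x R, t u := by
        rw [ENNReal.tsum_comm]; simp only [ENNReal.tsum_mul_left]
    _ = _ := by
        simp only [hcount, ← mul_assoc, ENNReal.tsum_mul_right]

theorem measure_no_trap (hind : iIndepFun f μ) {ρ q : ℝ≥0∞}
    (hq : ∀ z, μ {ω | ρ < f z ω} = q) (I : Finset (Lattice d)) :
    μ {ω | ∀ z ∈ I, ρ < f z ω} = q ^ I.card := by
  have h := hind.measure_inter_preimage_eq_mul (S := I) (sets := fun _ => Set.Ioi ρ)
    fun _ _ => measurableSet_Ioi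
  have h1 : (⋂ z ∈ I, f z ⁻¹' Set.Ioi ρ) = {ω | ∀ z ∈ I, ρ < f z ω} := by ext ω; simp
  rw [h1] at h
  rw [h, ← Finset.prod_const]
  exact Finset.prod_congr rfl fun z _ => hq z

theorem ae_exists_trap [NeZero d] (hind : iIndepFun f μ) {ρ q : ℝ≥0∞}
    (hq : ∀ z, μ {ω | ρ < f z ω} = q) (hq1 : q < 1) : ∀ᵐ ω ∂μ, ∃ t, f t ω ≤ ρ := by
  rw [ae_iff]
  have hle : ∀ R : ℕ, μ {ω | ¬ ∃ t, f t ω ≤ ρ} ≤ q ^ R := by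
    intro R
    refine (measure_mono (t := {ω | ∀ z ∈ cube (0 : Lattice d) R, ρ < f z ω}) ?_).trans ?_
    · intro ω hω z _
      exact not_le.1 fun h => hω ⟨z, h⟩
    · rw [measure_no_trap hind hq, card_cube]
      refine pow_le_pow_of_le_one zero_le hq1.le ?_
      have : (2 * (R : ℤ) + 1).toNat = 2 * R + 1 := by omega
      rw [this]
      exact le_trans (by omega) (Nat.le_self_pow (NeZero.ne d) _)
  exact le_antisymm (ge_of_tendsto' (ENNReal.tendsto_pow_atTop_nhds_zero_of_lt_one hq1) hle) zero_le

end Environment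

/-! ### Geodesics and lower bounds for annealed crossing weights. -/

/-- The `ℓ¹` distance on the lattice. -/
def distOne (u v : Lattice d) : ℕ := ∑ i, (u i - v i).natAbs

theorem distOne_eq_zero {u v : Lattice d} : distOne u v = 0 ↔ u = v := by
  simp [distOne, funext_iff, sub_eq_zero]

/-- Correct any coordinate in which u and v differ. Moving towards v cannot leave a box containing
both, which keeps geodesics inside cubes. -/
theorem exists_unitStep_closer {u v : Lattice d} {n : ℕ} (h : distOne u v = n + 1) :
    ∃ s : Fin d × Bool, distOne (u + unitStep s) v = n ∧
      ∀ a b : Lattice d, u ∈ Set.Icc a b → v ∈ Set.Icc a b → u + unitStep s ∈ Set.Icc a b := by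
  obtain ⟨i, hi⟩ : ∃ i, u i ≠ v i := by
    by_contra! h'
    rw [distOne_eq_zero.2 (funext h')] at h
    omega
  refine ⟨(i, decide (u i < v i)), ?_, fun a b hu hv => ?_⟩
  · unfold distOne at h ⊢
    rw [← Finset.add_sum_erase _ _ (Finset.mem_univ i)] at h ⊢
    have h1 : ∑ j ∈ Finset.univ.erase i, ((u + unitStep (i, decide (u i < v i))) j - v j).natAbs =
        ∑ j ∈ Finset.univ.erase i, (u j - v j).natAbs := by
      refine Finset.sum_congr rfl fun j hj => ?_
      simp [unitStep, Finset.ne_of_mem_erase hj]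
    rw [h1]
    simp only [unitStep, Pi.add_apply, Pi.single_eq_same, decide_eq_true_eq]
    split_ifs <;> omega
  · have key : ∀ j, a j ≤ (u + unitStep (i, decide (u i < v i))) j ∧
        (u + unitStep (i, decide (u i < v i))) j ≤ b j := by
      intro j
      have h1 : a j ≤ u j := hu.1 j
      have h2 : u j ≤ b j := hu.2 j
      have h3 : a j ≤ v j := hv.1 j
      have h4 : v j ≤ b j := hv.2 j
      by_cases hj : j = i
      · subst hj
        simp only [unitStep, Pi.add_apply, Pi.single_eq_same, decide_eq_true_eq]
        split_ifs <;> constructor <;> omega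
      · simp [unitStep, hj, h1, h2]
    exact ⟨fun j => (key j).1, fun j => (key j).2⟩

theorem innerWeight_mono (f : Lattice d → ℝ≥0∞) {B B' : Set (Lattice d)} (h : B ⊆ B')
    (u v : Lattice d) : innerWeight f B u v ≤ innerWeight f B' u v :=
  green_mono (fun z => Set.indicator_le_indicator_of_subset
    (Set.sdiff_subset_sdiff_left h) (fun _ => bot_le) z) le_rfl u

theorem innerWeight_self (f : Lattice d → ℝ≥0∞) (B : Set (Lattice d)) (v : Lattice d) :
    1 ≤ innerWeight f B v v := by
  simpa [innerWeight] using le_green ((B \ {v}).indicator f) (Pi.single v 1) v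

theorem innerWeight_step (f : Lattice d → ℝ≥0∞) {B : Set (Lattice d)} {u v : Lattice d}
    (hu : u ∈ B) (huv : u ≠ v) (s : Fin d × Bool) :
    (2 * (d : ℝ≥0∞))⁻¹ * f u * innerWeight f B (u + unitStep s) v ≤ innerWeight f B u v := by
  refine le_trans ?_ (killedStep_green_le ((B \ {v}).indicator f) (Pi.single v 1) u)
  have h : (B \ {v}).indicator f u = f u := 
    Set.indicator_of_mem (show u ∈ B \ {v} from ⟨hu, huv⟩) _
  rw [killedStep, h, mul_comm (2 * (d : ℝ≥0∞))⁻¹, mul_assoc]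
  exact mul_le_mul' le_rfl (le_nbrAvg _ u s)

/-- P is chosen before the environment, and its sites are distinct because the distance to v
strictly decreases along the path; hence the mean of the product factorises. -/
theorem exists_geodesic {a b v : Lattice d} (hv : v ∈ Set.Icc a b) (n : ℕ) :
    ∀ u ∈ Set.Icc a b, distOne u v = n → ∃ P : Finset (Lattice d), P.card = n ∧
      (∀ z ∈ P, distOne z v ≤ n) ∧ ∀ f : Lattice d → ℝ≥0∞,
        (2 * (d : ℝ≥0∞))⁻¹ ^ n * ∏ z ∈ P, f z ≤ innerWeight f (Set.Icc a b) u v := by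
  induction n with
  | zero =>
    intro u _ hd
    obtain rfl := distOne_eq_zero.1 hd
    exact ⟨∅, rfl, by simp, fun f => by simpa using innerWeight_self f _ u⟩
  | succ n ih =>
    intro u hu hd
    obtain ⟨s, hs, hs'⟩ := exists_unitStep_closer hd
    obtain ⟨P, hP, hPd, hPf⟩ := ih _ (hs' a b hu hv) hs
    have huP : u ∉ P := fun h => by have := hPd u h; omega
    refine ⟨insert u P, by rw [Finset.card_insert_of_notMem huP, hP], ?_, fun f => ?_⟩
    · intro z hz
      rcases Finset.mem_insert.1 hz with rfl | hz
      · exact hd.le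
      · exact (hPd z hz).trans (Nat.le_succ n)
    · have huv : u ≠ v := fun h => by rw [distOne_eq_zero.2 h] at hd; omega
      refine le_trans (le_trans (le_of_eq ?_) (mul_le_mul' le_rfl (hPf f)))
        (innerWeight_step f hu huv s)
      rw [Finset.prod_insert huP, pow_succ]
      ring

theorem mem_Icc_of_mem_cube {x z : Lattice d} {r : ℤ} (h : z ∈ cube x r) :
    z ∈ Set.Icc (fun i => x i - r) (fun i => x i + r) := Finset.mem_Icc.1 h

theorem distOne_le_of_mem_cube {x u v : Lattice d} {R : ℕ} (hu : u ∈ cube x R)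
    (hv : v ∈ cube x R) : distOne u v ≤ 2 * d * R := by
  refine (Finset.sum_le_card_nsmul Finset.univ _ (2 * R) fun i _ => ?_).trans (le_of_eq ?_)
  · have h1 := abs_le.1 (mem_cube.1 hu i); have h2 := abs_le.1 (mem_cube.1 hv i)
    omega
  · simp; ring

section Environment
variable {Ω : Type*} [MeasurableSpace Ω] {μ : Measure Ω} {f : Lattice d → Ω → ℝ≥0∞}

theorem le_lintegral_innerWeight (hf : ∀ z, Measurable (f z)) (hind : iIndepFun f μ) {β : ℝ≥0∞}
    (hβ : ∀ v, ∫⁻ ω, f v ω ∂μ = β) {a b u v : Lattice d} (hu : u ∈ Set.Icc a b)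
    (hv : v ∈ Set.Icc a b) :
    ((2 * (d : ℝ≥0∞))⁻¹ * β) ^ distOne u v ≤
      ∫⁻ ω, innerWeight (fun z => f z ω) (Set.Icc a b) u v ∂μ := by
  obtain ⟨P, hP, -, hPf⟩ := exists_geodesic hv _ u hu rfl
  refine le_trans (le_of_eq ?_) (lintegral_mono fun ω => hPf fun z => f z ω)
  rw [lintegral_const_mul _ (Finset.measurable_fun_prod _ fun z _ => hf z),
    lintegral_prod_eq_prod_lintegral_of_indepFun _ _ hind hf]
  simp [hβ, hP, mul_pow]

theorem le_lintegral_green [NeZero d] (hf : ∀ z, Measurable (f z)) (hind : iIndepFun f μ)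
    {β : ℝ≥0∞} (hβ : ∀ v, ∫⁻ ω, f v ω ∂μ = β) (x y : Lattice d) :
    ((2 * (d : ℝ≥0∞))⁻¹ * β) ^ distOne x y ≤
      ∫⁻ ω, green (({y}ᶜ : Set (Lattice d)).indicator fun z => f z ω) (Pi.single y 1) x ∂μ := by
  refine (le_lintegral_innerWeight hf hind hβ (a := x ⊓ y) (b := x ⊔ y)
    ⟨inf_le_left, le_sup_left⟩ ⟨inf_le_right, le_sup_right⟩).trans (lintegral_mono fun ω => ?_)
  refine (innerWeight_mono _ (Set.subset_univ _) x y).trans (le_of_eq ?_)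
  rw [innerWeight, Set.compl_eq_univ_sdiff]

/-- Linear growth in terms of the visited sites, from a bound `K` on the Green function near a trap
and a lower bound `α` on the annealed crossing weight of cubes. -/
theorem lintegral_green_green_le_through [NeZero d]
    (hf : ∀ z, Measurable (f z)) (hind : iIndepFun f μ) (hle : ∀ z ω, f z ω ≤ 1) {β : ℝ≥0∞}
    (hβ0 : β ≠ 0) (hβ1 : β ≤ 1) (hβ : ∀ v, ∫⁻ ω, f v ω ∂μ = β) {ρ q : ℝ≥0∞}
    (hq : ∀ z, μ {ω | ρ < f z ω} = q) (hq1 : q < 1) (K α : ℕ → ℝ≥0∞) (hα0 : ∀ R, α R ≠ 0)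
    (hα1 : ∀ R, α R ≠ ⊤)
    (hK : ∀ x R ω, (∃ t ∈ cube x (R : ℕ), f t ω ≤ ρ) → ∀ v ∈ cube x R, ∀ u,
      green (fun z => f z ω) (Pi.single v 1) u ≤ K R)
    (hα : ∀ x (R : ℕ), ∀ u ∈ cube x R, ∀ v ∈ cube x R,
      α R ≤ ∫⁻ ω, innerWeight (fun z => f z ω) (cube x R) u v ∂μ)
    (hsum : ∑' R : ℕ, (α R)⁻¹ * K R ^ 2 * q ^ (2 * R - 1) ^ d * (2 * R + 1) ^ (2 * d) ≠ ⊤) :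
    ∃ C : ℝ≥0∞, C ≠ ⊤ ∧ ∀ o y : Lattice d,
      ∫⁻ ω, green (({y}ᶜ : Set (Lattice d)).indicator fun z => f z ω)
        (green (({y}ᶜ : Set (Lattice d)).indicator fun z => f z ω) (Pi.single y 1)) o ∂μ ≤
      C * ∑' u, ∫⁻ ω, throughWeight (fun z => f z ω) o y u ∂μ := by
  -- The constant of `lintegral_box_le` for the cube of radius R. The exponent of q counts the sites
  -- at distance at most R - 1; truncated subtraction makes it 0 at R = 0.
  set c : ℕ → ℝ≥0∞ := fun R =>
    (α R * β)⁻¹ * (K R ^ 2 * q ^ (2 * R - 1) ^ d * (2 * R + 1) ^ d) with hc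
  have hβt : β ≠ ⊤ := ne_top_of_le_ne_top ENNReal.one_ne_top hβ1
  refine ⟨∑' R : ℕ, c R * (2 * R + 1) ^ d, ?_, fun o y => ?_⟩
  · have : ∀ R : ℕ, c R * (2 * R + 1) ^ d = β⁻¹ *
        ((α R)⁻¹ * K R ^ 2 * q ^ (2 * R - 1) ^ d * (2 * R + 1) ^ (2 * d)) := by
      intro R
      simp only [hc]
      rw [ENNReal.mul_inv (Or.inl (hα0 R)) (Or.inl (hα1 R)), two_mul d, pow_add]
      ring
    simp only [this, ENNReal.tsum_mul_left]
    exact ENNReal.mul_ne_top (ENNReal.inv_ne_top.2 hβ0) hsum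
  · refine lintegral_green_green_le hf (ae_exists_trap hind hq hq1) o y c fun x R => ?_
    have hsub : cube x ((R : ℤ) - 1) ⊆ cube x R := cube_mono x (by omega)
    have h := lintegral_box_le hf hind hle hsub (hK x R) (hα x R) hβ o y (self_mem_cube x R)
    have hcard1 : (cube x ((R : ℤ) - 1)).card = (2 * R - 1) ^ d := by
      rw [card_cube]; congr 1; omega
    have hcard2 : ((cube x (R : ℤ)).card : ℝ≥0∞) = (2 * R + 1) ^ d := by
      rw [card_cube, show (2 * (R : ℤ) + 1).toNat = 2 * R + 1 by omega]; push_cast; rfl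
    rw [measure_no_trap hind hq, hcard1, hcard2] at h
    have h0 : α R * β ≠ 0 := mul_ne_zero (hα0 R) hβ0
    have ht : α R * β ≠ ⊤ := ENNReal.mul_ne_top (hα1 R) hβt
    simp only [hc]
    rw [mul_assoc, ← ENNReal.mul_le_iff_le_inv h0 ht]
    exact h

end Environment

/-! ### From visited sites to linear growth of the hitting time. -/

theorem distOne_zero_le (y : Lattice d) : (distOne 0 y : ℝ) ≤ d * latticeNorm y := by
  unfold distOne latticeNorm
  push_cast
  refine (Finset.sum_le_card_nsmul Finset.univ _
    ‖(WithLp.toLp 2 (fun i => (y i : ℝ)) : EuclideanSpace ℝ (Fin d))‖ fun i _ => ?_).trans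
    (le_of_eq (by simp))
  have := PiLp.norm_apply_le (WithLp.toLp 2 (fun i => (y i : ℝ)) : EuclideanSpace ℝ (Fin d)) i
  refine le_trans (le_of_eq ?_) this
  simp [Nat.cast_natAbs]

theorem survival_measurable {Ω : Type*} [MeasurableSpace Ω] {V : Lattice d → Ω → ℝ≥0∞}
    (hV : ∀ z, Measurable (V z)) (z : Lattice d) :
    Measurable fun ω => survival (fun z => V z ω) z :=
  (measurable_coe_ennreal_ereal.comp (hV z)).neg.ereal_exp

theorem annealedHitTime_eq [NeZero d] {Ω : Type*} [MeasurableSpace Ω] (μ : Measure Ω)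
    [IsProbabilityMeasure μ] {V : Lattice d → Ω → ℝ≥0∞} (hV : ∀ z, Measurable (V z))
    (x y : Lattice d) :
    annealedHitTime μ V x y = (annealedPartition μ V x y)⁻¹ *
      ∫⁻ ω, ∫⁻ S, (hitTime y S : ℝ≥0∞) * weight (fun z => V z ω) y S ∂(walkLaw x) ∂μ := by
  have hw := measurable_weight hV y
  have hh : Measurable fun S : Path d => (hitTime y S : ℝ≥0∞) :=
    (measurable_of_countable (fun k : ℕ∞ => (k : ℝ≥0∞))).comp (measurable_hitTime y)
  have hh2 : Measurable fun p : Ω × Path d => (hitTime y p.2 : ℝ≥0∞) := hh.comp measurable_snd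
  rw [annealedHitTime, annealedMeasure, lintegral_smul_measure, smul_eq_mul,
    lintegral_map hh measurable_snd, lintegral_withDensity_eq_lintegral_mul _ hw hh2,
    lintegral_prod _ (hw.mul hh2).aemeasurable]
  simp only [Pi.mul_apply, mul_comm]

/-- Linear growth of the annealed hitting time, given its comparison with the visited sites. -/
theorem limsup_annealedHitTime_le [NeZero d] {Ω : Type*} [MeasurableSpace Ω] (μ : Measure Ω)
    [IsProbabilityMeasure μ] {V : Lattice d → Ω → ℝ≥0∞} (hV : ∀ z, Measurable (V z))
    (hind : iIndepFun (fun z ω => survival (fun z => V z ω) z) μ) {β : ℝ≥0∞} (hβ0 : β ≠ 0)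
    (hβ1 : β < 1) (hβ : ∀ z, ∫⁻ ω, survival (fun z => V z ω) z ∂μ = β)
    (hC : ∃ C : ℝ≥0∞, C ≠ ⊤ ∧ ∀ o y : Lattice d,
      ∫⁻ ω, green (({y}ᶜ : Set (Lattice d)).indicator (survival fun z => V z ω))
        (green (({y}ᶜ : Set (Lattice d)).indicator (survival fun z => V z ω))
          (Pi.single y 1)) o ∂μ ≤
      C * ∑' u, ∫⁻ ω, throughWeight (survival fun z => V z ω) o y u ∂μ) :
    ∃ C : ℝ, 0 < C ∧
      limsup (fun y : Lattice d => annealedHitTime μ V 0 y / ENNReal.ofReal (latticeNorm y))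
        (comap latticeNorm atTop) ≤ ENNReal.ofReal C := by
  obtain ⟨C, hCt, hC⟩ := hC
  have hf := survival_measurable hV
  have hle : ∀ z ω, survival (fun z => V z ω) z ≤ 1 := fun z ω => survival_le_one _ z
  set γ : ℝ≥0∞ := (2 * (d : ℝ≥0∞))⁻¹ * β with hγ
  have hd0 : (2 * (d : ℝ≥0∞))⁻¹ ≠ 0 := ENNReal.inv_ne_zero.2
    (ENNReal.mul_ne_top ENNReal.ofNat_ne_top (ENNReal.natCast_ne_top d))
  have hγ0 : γ ≠ 0 := mul_ne_zero hd0 hβ0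
  -- One geodesic step costs γ, so Z ≥ γ ^ `distOne 0 y`. With M = k * `distOne 0 y` the error β ^ M
  -- in the count of sites is at most Z.
  obtain ⟨k, hk⟩ : ∃ k : ℕ, β ^ k ≤ γ :=
    ((ENNReal.tendsto_pow_atTop_nhds_zero_of_lt_one hβ1).eventually
      (Iic_mem_nhds (pos_iff_ne_zero.2 hγ0))).exists
  have hβi : (1 - β)⁻¹ ≠ ⊤ := ENNReal.inv_ne_top.2 (tsub_pos_of_lt hβ1).ne'
  have main : ∀ y, annealedHitTime μ V 0 y ≤
      C * (((k * distOne 0 y : ℕ) : ℝ≥0∞) + 1 + (1 - β)⁻¹) := by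
    intro y
    set Z := annealedPartition μ V 0 y with hZ
    have hZe : Z = ∫⁻ ω, green (({y}ᶜ : Set (Lattice d)).indicator (survival fun z => V z ω))
        (Pi.single y 1) 0 ∂μ := by
      simp only [hZ, annealedPartition, quenchedPartition_eq_green]
    have hZl : γ ^ distOne 0 y ≤ Z := by
      rw [hZe]
      exact le_lintegral_green hf hind hβ 0 y
    have h1 := tsum_lintegral_throughWeight_le hf hind hle hβ1.le hβ 0 y (k * distOne 0 y)
    have h2 : β ^ (k * distOne 0 y) ≤ Z := by
      rw [pow_mul]
      exact (pow_le_pow_left' hk _).trans hZl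
    have h3 : ∫⁻ ω, ∫⁻ S, (hitTime y S : ℝ≥0∞) * weight (fun z => V z ω) y S ∂(walkLaw 0) ∂μ ≤
        C * (((k * distOne 0 y : ℕ) : ℝ≥0∞) + 1 + (1 - β)⁻¹) * Z := by
      refine (lintegral_mono fun ω => lintegral_hitTime_mul_weight_le (fun z => V z ω) 0 y).trans ?_
      refine (hC 0 y).trans ?_
      rw [mul_assoc]
      refine mul_le_mul' le_rfl (h1.trans ?_)
      rw [add_mul _ _ Z, ← hZe]
      gcongr
    rw [annealedHitTime_eq μ hV, ← hZ]
    refine (mul_le_mul' le_rfl h3).trans ?_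
    rw [mul_left_comm]
    exact mul_le_of_le_one_right zero_le (ENNReal.inv_mul_le_one Z)
  set D : ℝ≥0∞ := C * ((k * d : ℕ) + 1 + (1 - β)⁻¹) with hD
  have hDt : D ≠ ⊤ := ENNReal.mul_ne_top hCt (ENNReal.add_ne_top.2
    ⟨ENNReal.add_ne_top.2 ⟨ENNReal.natCast_ne_top _, ENNReal.one_ne_top⟩, hβi⟩)
  refine ⟨D.toReal + 1, by positivity, ?_⟩
  have hev : ∀ᶠ y : Lattice d in comap latticeNorm atTop, 1 ≤ latticeNorm y :=
    (eventually_ge_atTop (1 : ℝ)).comap latticeNorm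
  refine limsup_le_of_le (h := ?_)
  filter_upwards [hev] with y hy
  have hy0 : ENNReal.ofReal (latticeNorm y) ≠ 0 := by
    simpa using lt_of_lt_of_le one_pos hy
  have hy1 : (1 : ℝ≥0∞) ≤ ENNReal.ofReal (latticeNorm y) := by simpa using hy
  have hDle : D ≤ ENNReal.ofReal (D.toReal + 1) := by
    conv_lhs => rw [← ENNReal.ofReal_toReal hDt]
    exact ENNReal.ofReal_le_ofReal (by linarith)
  refine le_trans ?_ hDle
  rw [ENNReal.div_le_iff hy0 ENNReal.ofReal_ne_top]
  refine (main y).trans ?_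
  rw [hD, mul_assoc]
  refine mul_le_mul' le_rfl ?_
  rw [add_mul, add_mul]
  refine add_le_add (add_le_add ?_ (by simpa using hy1)) (le_mul_of_one_le_right zero_le hy1)
  have hn : (distOne 0 y : ℝ≥0∞) ≤ d * ENNReal.ofReal (latticeNorm y) := by
    have := ENNReal.ofReal_le_ofReal (distOne_zero_le y)
    rwa [ENNReal.ofReal_natCast, ENNReal.ofReal_mul (by positivity), ENNReal.ofReal_natCast] at this
  push_cast
  rw [mul_assoc]
  gcongr

/-! ### Dimension at least two. -/

/-- The Green function at `v` is bounded exponentially in the distance from `v` to a trap. -/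
theorem green_single_le_of_dist [NeZero d] {f : Lattice d → ℝ≥0∞} (hf : ∀ z, f z ≤ 1)
    {ρ : ℝ≥0∞} (hρ0 : ρ ≠ 0) (hρ : ρ < 1) {t : Lattice d} (ht : f t ≤ ρ) (u : Lattice d) (n : ℕ) :
    ∀ v, distOne v t = n → green f (Pi.single v 1) u ≤
      (ρ * (2 * (d : ℝ≥0∞))⁻¹)⁻¹ ^ n * (1 - ρ)⁻¹ := by
  have hd0 : (2 * (d : ℝ≥0∞)) ≠ 0 := mul_ne_zero two_ne_zero (by exact_mod_cast NeZero.ne d)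
  have hdt : (2 * (d : ℝ≥0∞)) ≠ ⊤ :=
    ENNReal.mul_ne_top ENNReal.ofNat_ne_top (ENNReal.natCast_ne_top d)
  have hd1 : (2 * (d : ℝ≥0∞))⁻¹ ≤ 1 := by
    rw [ENNReal.inv_le_one]
    exact_mod_cast Nat.succ_le_of_lt (Nat.mul_pos two_pos (Nat.pos_of_ne_zero (NeZero.ne d)))
  have hb0 : ρ * (2 * (d : ℝ≥0∞))⁻¹ ≠ 0 := mul_ne_zero hρ0 (ENNReal.inv_ne_zero.2 hdt)
  have hbt : ρ * (2 * (d : ℝ≥0∞))⁻¹ ≠ ⊤ :=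
    ENNReal.mul_ne_top hρ.ne_top (ENNReal.inv_ne_top.2 hd0)
  have hL : 1 ≤ (ρ * (2 * (d : ℝ≥0∞))⁻¹)⁻¹ :=
    ENNReal.one_le_inv.2 (mul_le_one' hρ.le hd1)
  induction n with
  | zero =>
    intro v hv
    rw [distOne_eq_zero.1 hv, pow_zero, one_mul]
    exact green_single_le_of_trap hf hρ ht u
  | succ n ih =>
    intro v hv
    -- Either v is itself a trap, or f v > ρ and the pole moves one step towards t at a bounded
    -- price.
    rcases le_or_gt (f v) ρ with h | h
    · exact (green_single_le_of_trap hf hρ h u).trans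
        (le_mul_of_one_le_left zero_le (one_le_pow_of_one_le' hL _))
    · obtain ⟨s, hs, -⟩ := exists_unitStep_closer hv
      have h1 : green f (Pi.single v 1) u * (ρ * (2 * (d : ℝ≥0∞))⁻¹) ≤
          (ρ * (2 * (d : ℝ≥0∞))⁻¹)⁻¹ ^ n * (1 - ρ)⁻¹ := by
        refine le_trans ?_ ((green_single_mul_le_of_nbr f u v s).trans (ih _ hs))
        gcongr
      rw [pow_succ', mul_assoc, ← ENNReal.mul_le_iff_le_inv hb0 hbt, mul_comm]
      exact h1

/-- The base `Λ * q ^ R` tends to zero, so all but finitely many terms are dominated by powers of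
one half. -/
theorem tsum_mul_pow_pow_ne_top {Λ q : ℝ≥0∞} (hΛ : Λ ≠ ⊤) (hq : q < 1) :
    ∑' R : ℕ, (Λ * q ^ R) ^ R ≠ ⊤ := by
  have h1 : Tendsto (fun R : ℕ => Λ * q ^ R) atTop (nhds 0) := by
    simpa using ENNReal.Tendsto.const_mul
      (ENNReal.tendsto_pow_atTop_nhds_zero_of_lt_one hq) (Or.inr hΛ)
  obtain ⟨N, hN⟩ := eventually_atTop.1 (h1.eventually
    (Iic_mem_nhds (show (0 : ℝ≥0∞) < 2⁻¹ by simp)))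
  have h2 : ∀ R : ℕ, (Λ * q ^ R) ^ R ≤ 2⁻¹ ^ R + (Finset.range N : Set ℕ).indicator
      (fun R => Λ ^ R) R := by
    intro R
    by_cases hR : R < N
    · rw [Set.indicator_of_mem (by simpa using hR)]
      refine le_trans (pow_le_pow_left' ?_ R) le_add_self
      exact mul_le_of_le_one_right zero_le (pow_le_one' hq.le R)
    · exact le_trans (pow_le_pow_left' (hN R (not_lt.1 hR)) R) le_self_add
  refine ne_top_of_le_ne_top ?_ (ENNReal.tsum_le_tsum h2)
  rw [ENNReal.tsum_add, ENNReal.tsum_geometric, ← sum_eq_tsum_indicator]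
  refine ENNReal.add_ne_top.2 ⟨by simp, ?_⟩
  exact ENNReal.sum_ne_top.2 fun R _ => ENNReal.pow_ne_top hΛ

section Environment
variable {Ω : Type*} [MeasurableSpace Ω] {μ : Measure Ω} {f : Lattice d → Ω → ℝ≥0∞}

/-- Above dimension one, the absence of traps costs more than any exponential in the radius. -/
theorem exists_lintegral_le_through_of_two_le [NeZero d] (hd : 2 ≤ d)
    (hf : ∀ z, Measurable (f z)) (hind : iIndepFun f μ) (hle : ∀ z ω, f z ω ≤ 1) {β : ℝ≥0∞}
    (hβ0 : β ≠ 0) (hβ1 : β ≤ 1) (hβ : ∀ v, ∫⁻ ω, f v ω ∂μ = β) {ρ q : ℝ≥0∞} (hρ0 : ρ ≠ 0)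
    (hρ : ρ < 1) (hq : ∀ z, μ {ω | ρ < f z ω} = q) (hq1 : q < 1) :
    ∃ C : ℝ≥0∞, C ≠ ⊤ ∧ ∀ o y : Lattice d,
      ∫⁻ ω, green (({y}ᶜ : Set (Lattice d)).indicator fun z => f z ω)
        (green (({y}ᶜ : Set (Lattice d)).indicator fun z => f z ω) (Pi.single y 1)) o ∂μ ≤
      C * ∑' u, ∫⁻ ω, throughWeight (fun z => f z ω) o y u ∂μ := by
  have hd0 : (2 * (d : ℝ≥0∞)) ≠ 0 := mul_ne_zero two_ne_zero (by exact_mod_cast NeZero.ne d)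
  have hdt : (2 * (d : ℝ≥0∞)) ≠ ⊤ :=
    ENNReal.mul_ne_top ENNReal.ofNat_ne_top (ENNReal.natCast_ne_top d)
  have hd1 : (2 * (d : ℝ≥0∞))⁻¹ ≤ 1 := by
    rw [ENNReal.inv_le_one]
    exact_mod_cast Nat.succ_le_of_lt (Nat.mul_pos two_pos (Nat.pos_of_ne_zero (NeZero.ne d)))
  set L : ℝ≥0∞ := (ρ * (2 * (d : ℝ≥0∞))⁻¹)⁻¹ with hL
  have hL1 : 1 ≤ L := ENNReal.one_le_inv.2 (mul_le_one' hρ.le hd1)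
  have hLt : L ≠ ⊤ := ENNReal.inv_ne_top.2 (mul_ne_zero hρ0 (ENNReal.inv_ne_zero.2 hdt))
  set γ : ℝ≥0∞ := (2 * (d : ℝ≥0∞))⁻¹ * β with hγ
  have hγ0 : γ ≠ 0 := mul_ne_zero (ENNReal.inv_ne_zero.2 hdt) hβ0
  have hγ1 : γ ≤ 1 := mul_le_one' hd1 hβ1
  have hK0 : (1 - ρ)⁻¹ ≠ ⊤ := ENNReal.inv_ne_top.2 (tsub_pos_of_lt hρ).ne'
  refine lintegral_green_green_le_through hf hind hle hβ0 hβ1 hβ hq hq1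
    (fun R => L ^ (2 * d * R) * (1 - ρ)⁻¹) (fun R => γ ^ (2 * d * R))
    (fun R => pow_ne_zero _ hγ0)
    (fun R => ENNReal.pow_ne_top (ne_top_of_le_ne_top ENNReal.one_ne_top hγ1)) ?_ ?_ ?_
  · rintro x R ω ⟨t, ht, hft⟩ v hv u
    refine (green_single_le_of_dist (fun z => hle z ω) hρ0 hρ hft u _ v rfl).trans ?_
    exact mul_le_mul' (pow_le_pow_right' hL1 (distOne_le_of_mem_cube hv ht)) le_rfl
  · intro x R u hu v hv
    refine (pow_le_pow_of_le_one zero_le hγ1 (distOne_le_of_mem_cube hu hv)).trans ?_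
    refine (le_lintegral_innerWeight hf hind hβ (mem_Icc_of_mem_cube hu)
      (mem_Icc_of_mem_cube hv)).trans (le_of_eq ?_)
    simp only [cube, Finset.coe_Icc]
  -- Λ collects all factors exponential in R, the volume being bounded by 2R + 1 ≤ 3^R. Dimension
  -- two enters through R² ≤ (2R - 1)^d, which leaves a factor q^R inside the R-th power.
  · set Λ : ℝ≥0∞ := (γ ^ (2 * d))⁻¹ * L ^ (4 * d) * 3 ^ (2 * d) with hΛ
    have hΛt : Λ ≠ ⊤ := ENNReal.mul_ne_top (ENNReal.mul_ne_top
      (ENNReal.inv_ne_top.2 (pow_ne_zero _ hγ0)) (ENNReal.pow_ne_top hLt))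
      (ENNReal.pow_ne_top ENNReal.ofNat_ne_top)
    have hterm : ∀ R : ℕ, (γ ^ (2 * d * R))⁻¹ * (L ^ (2 * d * R) * (1 - ρ)⁻¹) ^ 2 *
        q ^ (2 * R - 1) ^ d * (2 * R + 1) ^ (2 * d) ≤ ((1 - ρ)⁻¹) ^ 2 * (Λ * q ^ R) ^ R := by
      intro R
      have h1 : R * R ≤ (2 * R - 1) ^ d := by
        rcases Nat.eq_zero_or_pos R with rfl | hR
        · simp
        · calc R * R ≤ (2 * R - 1) ^ 2 := by rw [sq]; exact Nat.mul_le_mul (by omega) (by omega)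
            _ ≤ (2 * R - 1) ^ d := Nat.pow_le_pow_right (by omega) hd
      have h2 : 2 * R + 1 ≤ 3 ^ R := by
        have := one_add_mul_le_pow (a := (2 : ℤ)) (by norm_num) R
        norm_num at this
        zify; linarith
      have h3 : ((2 : ℝ≥0∞) * R + 1) ≤ 3 ^ R := by exact_mod_cast h2
      calc _ ≤ (γ ^ (2 * d * R))⁻¹ * (L ^ (2 * d * R) * (1 - ρ)⁻¹) ^ 2 *
            q ^ (R * R) * (3 ^ R) ^ (2 * d) := by
            exact mul_le_mul' (mul_le_mul' le_rfl (pow_le_pow_of_le_one zero_le hq1.le h1))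
              (pow_le_pow_left' h3 _)
        _ = _ := by
            have hG : (γ ^ (2 * d * R))⁻¹ = ((γ ^ (2 * d))⁻¹) ^ R := by
              rw [pow_mul γ, ENNReal.inv_pow]
            rw [hΛ, hG]
            clear_value L γ
            generalize (γ ^ (2 * d))⁻¹ = G
            ring
    refine ne_top_of_le_ne_top ?_ (ENNReal.tsum_le_tsum hterm)
    rw [ENNReal.tsum_mul_left]
    exact ENNReal.mul_ne_top (ENNReal.pow_ne_top hK0) (tsum_mul_pow_pow_ne_top hΛt hq1)

end Environment

/-! ### Dimension one: Green function near a trap and crossing of intervals. -/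

section OneDim

theorem nbrAvg_one (g : Lattice 1 → ℝ≥0∞) (x : Lattice 1) (s : Fin 1 × Bool) :
    nbrAvg g x = 2⁻¹ * (g (x + unitStep s) + g (x - unitStep s)) := by
  have hneg : unitStep (0, false) = -unitStep ((0 : Fin 1), true) := by
    simp [unitStep, Pi.single_neg]
  rcases s with ⟨i, b⟩
  obtain rfl : i = 0 := Subsingleton.elim _ _
  cases b <;> simp [nbrAvg, Fintype.sum_prod_type, hneg, sub_eq_add_neg, add_comm]

/-- In dimension one, the Green function at `v` is bounded linearly in the distance to a trap. -/
theorem green_single_le_one_dim {f : Lattice 1 → ℝ≥0∞} (hf : ∀ z, f z ≤ 1) {ρ : ℝ≥0∞}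
    (hρ : ρ < 1) {t : Lattice 1} (ht : f t ≤ ρ) (u v : Lattice 1) :
    green f (Pi.single v 1) u ≤ (1 - ρ)⁻¹ + 2 * distOne v t := by
  have h0 : 1 - ρ ≠ 0 := (tsub_pos_of_lt hρ).ne'
  have h1 : 1 - ρ ≠ ⊤ := ne_top_of_le_ne_top ENNReal.one_ne_top tsub_le_self
  have h2 : 1 + ρ * (1 - ρ)⁻¹ = (1 - ρ)⁻¹ := by
    nth_rewrite 1 [← ENNReal.mul_inv_cancel h0 h1]
    rw [← add_mul, tsub_add_cancel_of_le hρ.le, one_mul]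
  set c := (1 - ρ)⁻¹ with hc
  -- The Green function with pole v of the free walk killed at t: nonnegative by the triangle
  -- inequality, zero at t, with second difference 2 at t and -2 at v. The added constant c
  -- compensates the mass at t, where survival costs ρ.
  set n : Lattice 1 → ℕ := fun z => (|z 0 - t 0| + |v 0 - t 0| - |z 0 - v 0|).toNat with hn
  have hnt : n t = 0 := by
    simp only [hn, sub_self, abs_zero, zero_add, abs_sub_comm (t 0) (v 0)]; rfl
  have hle : n u ≤ 2 * distOne v t := by
    simp only [hn, distOne, Finset.univ_unique, Finset.sum_singleton, Fin.default_eq_zero]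
    have h3 := abs_sub_le (u 0) (v 0) (t 0)
    have h4 := Int.natCast_natAbs (v 0 - t 0)
    omega
  have hstep : ∀ z, (n (z + unitStep (0, true)) + n (z - unitStep (0, true)) +
      if z = v then 2 else 0 : ℕ) = 2 * n z + if z = t then 2 else 0 := by
    intro z
    have hzv : z = v ↔ z 0 = v 0 := by
      constructor
      · rintro rfl; rfl
      · intro h; ext i; rw [Subsingleton.elim i 0, h]
    have hzt : z = t ↔ z 0 = t 0 := by
      constructor
      · rintro rfl; rfl
      · intro h; ext i; rw [Subsingleton.elim i 0, h]
    simp only [hn, hzv, hzt, unitStep, Pi.add_apply, Pi.sub_apply, Pi.single_eq_same, if_true,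
      abs_eq_max_neg]
    split_ifs <;> omega
  have havg : ∀ z, nbrAvg (fun z => c + (n z : ℝ≥0∞)) z + (if z = v then 1 else 0) =
      c + n z + if z = t then 1 else 0 := by
    intro z
    have h3 : (2⁻¹ : ℝ≥0∞) * 2 = 1 := ENNReal.inv_mul_cancel two_ne_zero ENNReal.ofNat_ne_top
    have h4 := congrArg (fun k : ℕ => (2⁻¹ : ℝ≥0∞) * k) (hstep z)
    simp only [Nat.cast_add, Nat.cast_mul, Nat.cast_ite, Nat.cast_ofNat, Nat.cast_zero, mul_add,
      mul_ite, mul_zero, ← mul_assoc, h3, one_mul] at h4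
    rw [nbrAvg_one _ z (0, true), add_add_add_comm, mul_add, ← two_mul, ← mul_assoc, h3, one_mul,
      mul_add, add_assoc, h4, add_assoc]
  refine (green_le_of_supersolution (q := fun z => c + (n z : ℝ≥0∞)) (fun z => ?_) u).trans ?_
  · have h5 := havg z
    simp only [Pi.add_apply, killedStep, Pi.single_apply]
    by_cases hzt : z = t
    · subst hzt
      rw [hnt] at h5 ⊢
      simp only [Nat.cast_zero, add_zero, if_true] at h5 ⊢
      by_cases hzv : z = v
      · simp only [hzv, if_true] at h5 ⊢
        rw [WithTop.add_right_cancel ENNReal.one_ne_top h5, ← hzv]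
        conv_rhs => rw [← h2]
        gcongr
      · simp only [hzv, if_false, add_zero, zero_add] at h5 ⊢
        rw [h5]
        calc f z * (c + 1) ≤ ρ * (c + 1) := by gcongr
          _ = ρ * c + ρ := by ring
          _ ≤ ρ * c + 1 := by gcongr
          _ = c := by rw [add_comm, h2]
    · simp only [hzt, if_false, add_zero] at h5
      rw [← h5, add_comm]
      exact add_le_add (mul_le_of_le_one_left zero_le (hf z)) le_rfl
  · refine add_le_add le_rfl ?_
    exact_mod_cast hle

/-- The first `L` sites of the half line from `a` in direction `s`. -/
def halfLine (s : Fin 1 × Bool) (a : Lattice 1) (L : ℕ) : Set (Lattice 1) :=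
  {z | ∃ k < L, z = a + k • unitStep s}

/-- The weight of crossing `halfLine s a L` without leaving it. -/
def crossWeight (f : Lattice 1 → ℝ≥0∞) (s : Fin 1 × Bool) (a : Lattice 1) (L : ℕ) : ℝ≥0∞ :=
  innerWeight f (halfLine s a L) a (a + L • unitStep s)

theorem add_nsmul_unitStep_injective (s : Fin 1 × Bool) (a : Lattice 1) :
    Function.Injective fun k : ℕ => a + k • unitStep s := by
  intro k l h
  have h1 := congrFun (add_left_cancel h) s.1
  simp only [unitStep, Pi.smul_apply, Pi.single_eq_same, nsmul_eq_mul] at h1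
  split_ifs at h1 <;> omega

/-- On first reaching the intermediate site, continue with a crossing of the remaining stretch; both
pieces stay in the long one. -/
theorem crossWeight_mul_le (f : Lattice 1 → ℝ≥0∞) (s : Fin 1 × Bool) (a : Lattice 1) (g L : ℕ) :
    crossWeight f s a g * crossWeight f s (a + g • unitStep s) L ≤ crossWeight f s a (g + L) := by
  have hend : a + g • unitStep s + L • unitStep s = a + (g + L) • unitStep s := by
    rw [add_assoc, add_smul]
  set q := green ((halfLine s a (g + L) \ {a + (g + L) • unitStep s}).indicator f)
    (Pi.single (a + (g + L) • unitStep s) 1) with hq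
  have h1 : crossWeight f s (a + g • unitStep s) L ≤ q (a + g • unitStep s) := by
    rw [crossWeight, hend]
    refine innerWeight_mono f ?_ _ _
    rintro z ⟨k, hk, rfl⟩
    exact ⟨g + k, by omega, by rw [add_assoc, add_smul]⟩
  refine (mul_le_mul' le_rfl h1).trans ?_
  refine green_single_mul_le (by simp) (le_trans (killedStep_mono (fun z => ?_) le_rfl)
    (killedStep_green_le _ _)) a
  refine Set.indicator_le_indicator_of_subset ?_ (fun _ => bot_le) z
  rintro z ⟨⟨k, hk, rfl⟩, -⟩
  refine ⟨⟨k, by omega, rfl⟩, fun h => ?_⟩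
  have := add_nsmul_unitStep_injective s a h
  omega

/-- Gambler's ruin: crossing `g` sites that are free except for the first one. -/
theorem le_crossWeight_of_free {f : Lattice 1 → ℝ≥0∞} (hf : ∀ z, f z ≤ 1) (s : Fin 1 × Bool)
    (a : Lattice 1) {g : ℕ} (hg : 0 < g) (h1 : ∀ k, 0 < k → k < g → f (a + k • unitStep s) = 1) :
    f a * (2 * (g : ℝ≥0∞))⁻¹ ≤ crossWeight f s a g := by
  set e := unitStep s with he
  set F := (halfLine s a g \ {a + g • e}).indicator f with hF
  set q := green F (Pi.single (a + g • e) 1) with hq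
  have hFk : ∀ k < g, F (a + k • e) = f (a + k • e) := fun k hk =>
    Set.indicator_of_mem (show a + k • e ∈ halfLine s a g \ {a + g • e} from
      ⟨⟨k, hk, rfl⟩, fun h => by
        have := add_nsmul_unitStep_injective s a h
        omega⟩) _
  have hF1 : ∀ z, F z ≤ 1 := fun z => (Set.indicator_le_self _ f z).trans (hf z)
  have hq1 : ∀ z, q z ≤ 1 := fun z => by
    have h := green_single_le_of_trap hF1 zero_lt_one
      (show F (a + g • e) ≤ 0 by simp [hF, -nsmul_eq_mul]) z
    rwa [tsub_zero, inv_one] at h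
  have hqt : ∀ z, q z ≠ ⊤ := fun z => ne_top_of_le_ne_top ENNReal.one_ne_top (hq1 z)
  have hqeq : ∀ z, q z = (Pi.single (a + g • e) 1 : Lattice 1 → ℝ≥0∞) z +
      F z * (2⁻¹ * (q (z + e) + q (z - e))) := by
    intro z
    conv_lhs => rw [hq, green_eq_add_killedStep]
    rw [Pi.add_apply, killedStep, nbrAvg_one _ z s]
  -- On the free sites r is harmonic, hence affine up to r g = 1. The equation at a, keeping only
  -- the forward step, bounds r 0 from below.
  set r : ℕ → ℝ := fun k => (q (a + k • e)).toReal with hr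
  have hsucc : ∀ k : ℕ, a + k • e + e = a + (k + 1) • e := fun k => by
    rw [add_assoc, succ_nsmul]
  have hrg : r g = 1 := by
    have h := hqeq (a + g • e)
    have h' : F (a + g • e) = 0 := by simp [hF, -nsmul_eq_mul]
    rw [h'] at h
    simp [hr, h, -nsmul_eq_mul]
  have hsingle : ∀ k < g, (Pi.single (a + g • e) 1 : Lattice 1 → ℝ≥0∞) (a + k • e) = 0 := by
    intro k hk
    have : a + k • e ≠ a + g • e := fun h => by
      have := add_nsmul_unitStep_injective s a h
      omega
    simp [-add_right_inj, -nsmul_eq_mul, this]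
  have hrint : ∀ k, k + 1 < g → r (k + 1) = (r (k + 2) + r k) / 2 := by
    intro k hk
    have h := hqeq (a + (k + 1) • e)
    rw [hsingle _ hk, hFk _ hk, h1 _ (Nat.succ_pos k) hk, hsucc, zero_add, one_mul, ← hsucc k,
      add_sub_cancel_right] at h
    have h' := congrArg ENNReal.toReal h
    rw [ENNReal.toReal_mul, ENNReal.toReal_add (hqt _) (hqt _), hsucc] at h'
    change (q (a + (k + 1) • e)).toReal =
      ((q (a + (k + 1 + 1) • e)).toReal + (q (a + k • e)).toReal) / 2
    rw [h', ENNReal.toReal_inv, ENNReal.toReal_ofNat]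
    ring
  have hlin : ∀ k, k + 1 ≤ g → r (k + 1) - r k = r 1 - r 0 := by
    intro k
    induction k with
    | zero => intro _; rfl
    | succ k ih =>
      intro hk
      have h2 := hrint k (by omega)
      have h3 := ih (by omega)
      linarith
  have haff : ∀ k, k ≤ g → r k = r 0 + k * (r 1 - r 0) := by
    intro k
    induction k with
    | zero => intro _; simp
    | succ k ih =>
      intro hk
      have h2 := hlin k hk
      have h3 := ih (by omega)
      push_cast
      linarith
  have h0 : (f a).toReal / 2 * r 1 ≤ r 0 := by
    have h := hqeq (a + 0 • e)
    rw [hsingle _ hg, hFk _ hg, hsucc, zero_add] at h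
    have h2 : f a * (2⁻¹ * q (a + 1 • e)) ≤ q (a + 0 • e) := by
      rw [h, zero_smul, add_zero, zero_add]
      gcongr
      exact le_self_add
    have h' := ENNReal.toReal_mono (hqt _) h2
    rw [ENNReal.toReal_mul, ENNReal.toReal_mul] at h'
    refine le_trans (le_of_eq ?_) h'
    change (f a).toReal / 2 * (q (a + 1 • e)).toReal = _
    rw [ENNReal.toReal_inv, ENNReal.toReal_ofNat]
    ring
  have hg' : (0 : ℝ) < g := by exact_mod_cast hg
  have hfa : (f a).toReal ≤ 1 := by simpa using ENNReal.toReal_mono ENNReal.one_ne_top (hf a)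
  have hfa0 : 0 ≤ (f a).toReal := ENNReal.toReal_nonneg
  have hr0 : 0 ≤ r 0 := ENNReal.toReal_nonneg
  have hlast := haff g le_rfl
  rw [hrg] at hlast
  -- Insert r 1 = r 0 + (1 - r 0)/g and drop the nonnegative part r 0 - r 0/g.
  have hfin : (f a).toReal * (2 * (g : ℝ))⁻¹ ≤ r 0 := by
    have hΔ : r 1 = r 0 + (1 - r 0) / g := by field_simp; linarith
    rw [hΔ] at h0
    have hg1 : (1 : ℝ) ≤ g := by exact_mod_cast hg
    have h5 : 0 ≤ r 0 - r 0 / g := by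
      rw [sub_nonneg]; exact div_le_self hr0 hg1
    have h6 : (f a).toReal / 2 * (1 / g) ≤ (f a).toReal / 2 * (r 0 + (1 - r 0) / g) := by
      refine mul_le_mul_of_nonneg_left ?_ (by positivity)
      rw [sub_div]; linarith
    refine le_trans (le_of_eq ?_) (h6.trans h0)
    rw [mul_inv]; ring
  have hcw : crossWeight f s a g = q (a + 0 • e) := by
    rw [zero_smul, add_zero]; rfl
  rw [hcw, ← ENNReal.ofReal_toReal (hqt (a + 0 • e))]
  refine le_trans (le_of_eq ?_) (ENNReal.ofReal_le_ofReal hfin)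
  have hfat : f a ≠ ⊤ := ne_top_of_le_ne_top ENNReal.one_ne_top (hf a)
  rw [ENNReal.ofReal_mul hfa0, ENNReal.ofReal_toReal hfat, ENNReal.ofReal_inv_of_pos (by positivity),
    ENNReal.ofReal_mul two_pos.le]
  simp

end OneDim

/-! ### Renewal structure of moderate sites separated by free gaps. -/

/-- The indicator that the survival weight `t` is moderate: at least `κ` but less than one. -/
def moderate (κ t : ℝ≥0∞) : ℝ≥0∞ := (Set.Ico κ 1).indicator 1 t

/-- The indicator that the survival weight `t` is at least one. -/
def free (t : ℝ≥0∞) : ℝ≥0∞ := (Set.Ici 1).indicator 1 t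

theorem measurable_moderate (κ : ℝ≥0∞) : Measurable (moderate κ) :=
  measurable_one.indicator measurableSet_Ico

theorem measurable_free : Measurable free := measurable_one.indicator measurableSet_Ici

/-- The indicator of a moderate site at `a` followed by `g` free sites. -/
def gapWeight (κ : ℝ≥0∞) (f : Lattice 1 → ℝ≥0∞) (s : Fin 1 × Bool) (a : Lattice 1) (g : ℕ) :
    ℝ≥0∞ :=
  moderate κ (f a) * ∏ k ∈ Finset.range g, free (f (a + (k + 1) • unitStep s))

theorem moderate_eq (κ t : ℝ≥0∞) : moderate κ t = 0 ∨ moderate κ t = 1 ∧ κ ≤ t ∧ t < 1 := by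
  by_cases h : t ∈ Set.Ico κ 1
  · exact Or.inr ⟨Set.indicator_of_mem h _, h⟩
  · exact Or.inl (Set.indicator_of_notMem h _)

theorem moderate_le_one (κ t : ℝ≥0∞) : moderate κ t ≤ 1 := by
  rcases moderate_eq κ t with h | ⟨h, -⟩ <;> simp [h]

theorem free_eq (t : ℝ≥0∞) : free t = 0 ∨ free t = 1 ∧ 1 ≤ t := by
  by_cases h : t ∈ Set.Ici 1
  · exact Or.inr ⟨Set.indicator_of_mem h _, h⟩
  · exact Or.inl (Set.indicator_of_notMem h _)

theorem gapWeight_eq (κ : ℝ≥0∞) (f : Lattice 1 → ℝ≥0∞) (s : Fin 1 × Bool) (a : Lattice 1)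
    (g : ℕ) : gapWeight κ f s a g = 0 ∨ gapWeight κ f s a g = 1 ∧ moderate κ (f a) = 1 ∧
      κ ≤ f a ∧ ∀ k < g, 1 ≤ f (a + (k + 1) • unitStep s) := by
  rcases moderate_eq κ (f a) with h | ⟨h, h', -⟩
  · exact Or.inl (by simp [gapWeight, h])
  by_cases hk : ∀ k < g, free (f (a + (k + 1) • unitStep s)) = 1
  · refine Or.inr ⟨?_, h, h', fun k hkg => ?_⟩
    · rw [gapWeight, h, one_mul]
      exact Finset.prod_eq_one fun k hkg => hk k (Finset.mem_range.1 hkg)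
    · rcases free_eq (f (a + (k + 1) • unitStep s)) with h0 | h0
      · rw [hk k hkg] at h0; exact absurd h0 one_ne_zero
      · exact h0.2
  · push Not at hk
    obtain ⟨k, hkg, hk⟩ := hk
    refine Or.inl ?_
    rw [gapWeight, Finset.prod_eq_zero (Finset.mem_range.2 hkg)
      ((free_eq _).resolve_right fun h => hk h.1), mul_zero]

theorem gapWeight_mul_le_crossWeight {f : Lattice 1 → ℝ≥0∞} (hf : ∀ z, f z ≤ 1) (κ : ℝ≥0∞)
    (s : Fin 1 × Bool) (a : Lattice 1) (g : ℕ) :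
    gapWeight κ f s a g * (κ * (2 * ((g + 1 : ℕ) : ℝ≥0∞))⁻¹) ≤ crossWeight f s a (g + 1) := by
  rcases gapWeight_eq κ f s a g with h | ⟨h, -, h2, h3⟩
  · simp [h]
  · rw [h, one_mul]
    refine le_trans (mul_le_mul' h2 le_rfl) (le_crossWeight_of_free hf s a (Nat.succ_pos g) ?_)
    intro k hk hkg
    obtain ⟨j, rfl⟩ := Nat.exists_eq_succ_of_ne_zero hk.ne'
    exact le_antisymm (hf _) (h3 j (by omega))

theorem gapWeight_mul_moderate (κ : ℝ≥0∞) (f : Lattice 1 → ℝ≥0∞) (s : Fin 1 × Bool)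
    (a : Lattice 1) (g : ℕ) :
    gapWeight κ f s a g * moderate κ (f a) = gapWeight κ f s a g := by
  rcases gapWeight_eq κ f s a g with h | ⟨h, h', -⟩
  · simp [h]
  · rw [h', mul_one]

/-- Decomposition of the crossing weight at the first moderate site after `a`. -/
theorem sum_gapWeight_mul_le {f : Lattice 1 → ℝ≥0∞} (hf : ∀ z, f z ≤ 1) (κ : ℝ≥0∞)
    (s : Fin 1 × Bool) (a : Lattice 1) {G L : ℕ} (hL : G < L) :
    ∑ g ∈ Finset.range G, gapWeight κ f s a g * (κ * (2 * ((g + 1 : ℕ) : ℝ≥0∞))⁻¹) *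
        (moderate κ (f (a + (g + 1) • unitStep s)) *
          crossWeight f s (a + (g + 1) • unitStep s) (L - (g + 1))) ≤
      moderate κ (f a) * crossWeight f s a L := by
  set T : ℕ → ℝ≥0∞ := fun g => gapWeight κ f s a g * (κ * (2 * ((g + 1 : ℕ) : ℝ≥0∞))⁻¹) *
        (moderate κ (f (a + (g + 1) • unitStep s)) *
          crossWeight f s (a + (g + 1) • unitStep s) (L - (g + 1))) with hT
  have hle : ∀ g ∈ Finset.range G, T g ≤ moderate κ (f a) * crossWeight f s a L := by
    intro g hg
    have hgL : g + 1 + (L - (g + 1)) = L := by have := Finset.mem_range.1 hg; omega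
    have h1 := crossWeight_mul_le f s a (g + 1) (L - (g + 1))
    rw [hgL] at h1
    calc T g = moderate κ (f a) * (gapWeight κ f s a g * (κ * (2 * ((g + 1 : ℕ) : ℝ≥0∞))⁻¹)) *
          (moderate κ (f (a + (g + 1) • unitStep s)) *
            crossWeight f s (a + (g + 1) • unitStep s) (L - (g + 1))) := by
          simp only [hT]
          conv_lhs => rw [← gapWeight_mul_moderate]
          ring
      _ ≤ moderate κ (f a) * crossWeight f s a (g + 1) *
          (1 * crossWeight f s (a + (g + 1) • unitStep s) (L - (g + 1))) :=
          mul_le_mul' (mul_le_mul' le_rfl (gapWeight_mul_le_crossWeight hf κ s a g))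
            (mul_le_mul' (moderate_le_one κ _) le_rfl)
      _ ≤ _ := by
          rw [one_mul, mul_assoc]
          exact mul_le_mul' le_rfl h1
  -- At most one term is nonzero: a site is never both moderate and free, so the environment
  -- determines the first moderate site after a.
  by_cases h0 : ∀ g ∈ Finset.range G, T g = 0
  · rw [Finset.sum_eq_zero h0]; exact zero_le
  · push Not at h0
    obtain ⟨g, hg, hTg⟩ := h0
    rw [Finset.sum_eq_single g]
    · exact hle g hg
    · intro g' _ hne
      by_contra hTg'
      have key : ∀ i j, i < j → T i ≠ 0 → T j ≠ 0 → False := by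
        intro i j hij hi hj
        have h1 : moderate κ (f (a + (i + 1) • unitStep s)) ≠ 0 := fun h =>
          hi (by simp only [hT, h, zero_mul, mul_zero])
        have h2 : gapWeight κ f s a j ≠ 0 := fun h => hj (by simp only [hT, h, zero_mul])
        have h3 := ((moderate_eq κ _).resolve_left h1).2.2
        have h4 := ((gapWeight_eq κ f s a j).resolve_left h2).2.2.2 i hij
        exact absurd h3 (not_lt.2 h4)
      rcases lt_or_gt_of_ne hne with h | h
      · exact key _ _ h hTg' hTg
      · exact key _ _ h hTg hTg'
    · exact fun h => absurd hg h

section Environment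
variable {Ω : Type*} [MeasurableSpace Ω] {μ : Measure Ω} {f : Lattice 1 → Ω → ℝ≥0∞}

theorem lintegral_gapWeight (hf : ∀ z, Measurable (f z)) (hind : iIndepFun f μ) {κ σ p : ℝ≥0∞}
    (hσ : ∀ z, ∫⁻ ω, moderate κ (f z ω) ∂μ = σ) (hp : ∀ z, ∫⁻ ω, free (f z ω) ∂μ = p)
    (s : Fin 1 × Bool) (a : Lattice 1) (g : ℕ) :
    ∫⁻ ω, gapWeight κ (fun z => f z ω) s a g ∂μ = σ * p ^ g := by
  set h : ℕ → ℝ≥0∞ → ℝ≥0∞ := fun k => if k = 0 then moderate κ else free with hh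
  have hm : ∀ k, Measurable (h k) := fun k => by
    simp only [hh]; split_ifs
    · exact measurable_moderate κ
    · exact measurable_free
  have hind' : iIndepFun (fun k : ℕ => h k ∘ f (a + k • unitStep s)) μ :=
    (hind.precomp (add_nsmul_unitStep_injective s a)).comp h hm
  have heq : ∀ ω, gapWeight κ (fun z => f z ω) s a g =
      ∏ k ∈ Finset.range (g + 1), (h k ∘ f (a + k • unitStep s)) ω := by
    intro ω
    rw [Finset.prod_range_succ', mul_comm]
    simp [gapWeight, hh]
  simp only [heq]
  rw [lintegral_prod_eq_prod_lintegral_of_indepFun _ _ hind' fun k => (hm k).comp (hf _),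
    Finset.prod_range_succ']
  simp [hh, hσ, hp, mul_comm]

theorem measurable_gapWeight {Ω : Type*} {f : Lattice 1 → Ω → ℝ≥0∞} (κ : ℝ≥0∞)
    (s : Fin 1 × Bool) (a : Lattice 1) (g : ℕ) :
    Measurable[siteSigma f (halfLine s a (g + 1))] fun ω =>
      gapWeight κ (fun z => f z ω) s a g := by
  let m : MeasurableSpace Ω := siteSigma f (halfLine s a (g + 1))
  have h1 : Measurable[m] fun ω => moderate κ (f a ω) :=
    (measurable_moderate κ).comp (measurable_siteSigma ⟨0, by omega, by simp⟩)
  have h2 : Measurable[m] fun ω => ∏ k ∈ Finset.range g, free (f (a + (k + 1) • unitStep s) ω) :=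
    Finset.measurable_fun_prod _ fun k hk => measurable_free.comp
      (measurable_siteSigma ⟨k + 1, by have := Finset.mem_range.1 hk; omega, rfl⟩)
  exact h1.mul h2

theorem measurable_moderate_mul_crossWeight {Ω : Type*} {f : Lattice 1 → Ω → ℝ≥0∞} (κ : ℝ≥0∞)
    (s : Fin 1 × Bool) (a : Lattice 1) {L : ℕ} (hL : 0 < L) :
    Measurable[siteSigma f (halfLine s a L)] fun ω =>
      moderate κ (f a ω) * crossWeight (fun z => f z ω) s a L := by
  let m : MeasurableSpace Ω := siteSigma f (halfLine s a L)
  have h1 : Measurable[m] fun ω => moderate κ (f a ω) :=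
    (measurable_moderate κ).comp (measurable_siteSigma ⟨0, hL, by simp⟩)
  have h2 : Measurable[m] fun ω => crossWeight (fun z => f z ω) s a L :=
    (measurable_innerWeight (f := f) (halfLine s a L) a (a + L • unitStep s)).mono
      (biSup_mono fun z hz => hz.1) le_rfl
  exact h1.mul h2

/-- Exponential growth rate of the crossing weight, by comparison with a renewal sequence. -/
theorem le_lintegral_crossWeight (hf : ∀ z, Measurable (f z)) (hind : iIndepFun f μ)
    (hle : ∀ z ω, f z ω ≤ 1) {κ σ p θ c : ℝ≥0∞}
    (hσ : ∀ z, ∫⁻ ω, moderate κ (f z ω) ∂μ = σ) (hp : ∀ z, ∫⁻ ω, free (f z ω) ∂μ = p)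
    (hθ0 : θ ≠ 0) (hθ1 : θ ≤ 1) {G : ℕ}
    (hG : 1 ≤ ∑ g ∈ Finset.range G, κ * (2 * ((g + 1 : ℕ) : ℝ≥0∞))⁻¹ * (σ * p ^ g) *
      θ⁻¹ ^ (g + 1))
    (hc : ∀ g < G, c ≤ κ * (2 * ((g + 1 : ℕ) : ℝ≥0∞))⁻¹ * (σ * p ^ g))
    (s : Fin 1 × Bool) (L : ℕ) : ∀ a, 0 < L →
    c * θ ^ L ≤ ∫⁻ ω, moderate κ (f a ω) * crossWeight (fun z => f z ω) s a L ∂μ := by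
  induction L using Nat.strong_induction_on with
  | _ L ih =>
  intro a hL
  have hgm : ∀ g, Measurable fun ω => gapWeight κ (fun z => f z ω) s a g := fun g =>
    (measurable_gapWeight κ s a g).mono (siteSigma_le hf _) le_rfl
  -- For L > G the renewal inequality `hG` carries the lower bound over from shorter stretches. For
  -- L ≤ G a single gap of L - 1 free sites suffices, by `hc`.
  rcases lt_or_ge G L with hGL | hGL
  · have hcm : ∀ g ∈ Finset.range G, Measurable fun ω =>
        moderate κ (f (a + (g + 1) • unitStep s) ω) *
          crossWeight (fun z => f z ω) s (a + (g + 1) • unitStep s) (L - (g + 1)) := fun g hg =>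
      (measurable_moderate_mul_crossWeight κ s _
        (by have := Finset.mem_range.1 hg; omega)).mono (siteSigma_le hf _) le_rfl
    have hpm : ∀ g ∈ Finset.range G, AEMeasurable (fun ω =>
        gapWeight κ (fun z => f z ω) s a g * (κ * (2 * ((g + 1 : ℕ) : ℝ≥0∞))⁻¹) *
          (moderate κ (f (a + (g + 1) • unitStep s) ω) *
            crossWeight (fun z => f z ω) s (a + (g + 1) • unitStep s) (L - (g + 1)))) μ :=
      fun g hg => (((hgm g).mul_const _).mul (hcm g hg)).aemeasurable
    refine le_trans ?_ (lintegral_mono fun ω => sum_gapWeight_mul_le (fun z => hle z ω) κ s a hGL)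
    rw [lintegral_finsetSum' _ hpm]
    have hterm : ∀ g ∈ Finset.range G,
        κ * (2 * ((g + 1 : ℕ) : ℝ≥0∞))⁻¹ * (σ * p ^ g) * θ⁻¹ ^ (g + 1) * (c * θ ^ L) ≤
        ∫⁻ ω, gapWeight κ (fun z => f z ω) s a g * (κ * (2 * ((g + 1 : ℕ) : ℝ≥0∞))⁻¹) *
          (moderate κ (f (a + (g + 1) • unitStep s) ω) *
            crossWeight (fun z => f z ω) s (a + (g + 1) • unitStep s) (L - (g + 1))) ∂μ := by
      intro g hg
      have hg' := Finset.mem_range.1 hg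
      -- The moderate site ending the gap belongs to the next stretch, so the two factors use
      -- disjoint sets of sites.
      have hdisj : Disjoint (halfLine s a (g + 1))
          (halfLine s (a + (g + 1) • unitStep s) (L - (g + 1))) := by
        rw [Set.disjoint_left]
        rintro z ⟨k, hk, rfl⟩ ⟨l, hl, hl'⟩
        rw [add_assoc, ← add_smul] at hl'
        have := add_nsmul_unitStep_injective s a hl'
        omega
      have hX : Measurable[siteSigma f (halfLine s a (g + 1))] fun ω =>
          gapWeight κ (fun z => f z ω) s a g * (κ * (2 * ((g + 1 : ℕ) : ℝ≥0∞))⁻¹) :=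
        (measurable_gapWeight κ s a g).mul_const _
      rw [lintegral_mul_of_disjoint hf hind hdisj hX
        (measurable_moderate_mul_crossWeight κ s _ (by omega)),
        lintegral_mul_const _ (hgm g), lintegral_gapWeight hf hind hσ hp]
      have h1 := ih (L - (g + 1)) (by omega) (a + (g + 1) • unitStep s) (by omega)
      have h2 : θ⁻¹ ^ (g + 1) * θ ^ L = θ ^ (L - (g + 1)) := by
        obtain ⟨j, rfl⟩ : ∃ j, L = g + 1 + j := ⟨L - (g + 1), by omega⟩
        rw [pow_add θ (g + 1) j, ← mul_assoc, ← mul_pow,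
          ENNReal.inv_mul_cancel hθ0 (ne_top_of_le_ne_top ENNReal.one_ne_top hθ1),
          one_pow, one_mul, Nat.add_sub_cancel_left]
      calc _ = σ * p ^ g * (κ * (2 * ((g + 1 : ℕ) : ℝ≥0∞))⁻¹) * (c * (θ⁻¹ ^ (g + 1) * θ ^ L)) := by
            ring
        _ ≤ _ := by rw [h2]; exact mul_le_mul' le_rfl h1
    refine le_trans ?_ (Finset.sum_le_sum hterm)
    rw [← Finset.sum_mul]
    exact le_mul_of_one_le_left zero_le hG
  · obtain ⟨g, rfl⟩ := Nat.exists_eq_succ_of_ne_zero hL.ne'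
    have h1 : ∀ ω, gapWeight κ (fun z => f z ω) s a g * (κ * (2 * ((g + 1 : ℕ) : ℝ≥0∞))⁻¹) ≤
        moderate κ (f a ω) * crossWeight (fun z => f z ω) s a (g + 1) := by
      intro ω
      rw [← gapWeight_mul_moderate, mul_comm (gapWeight _ _ _ _ _), mul_assoc]
      exact mul_le_mul' le_rfl (gapWeight_mul_le_crossWeight (fun z => hle z ω) κ s a g)
    refine le_trans ?_ (lintegral_mono h1)
    rw [lintegral_mul_const _ (hgm g), lintegral_gapWeight hf hind hσ hp]
    refine (mul_le_of_le_one_right zero_le (pow_le_one' hθ1 _)).trans ((hc g (by omega)).trans ?_)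
    rw [mul_comm]

end Environment

/-! ### Crossing rate and convergence of the series in dimension one. -/

/-- At θ = p the sum is τ/(2p) times a partial sum of the harmonic series, hence exceeds 1 for large
G; by continuity it still does for some θ slightly above p. -/
theorem exists_rate_of_pos {τ p : ℝ} (hτ : 0 < τ) (hp : 0 < p) (hp1 : p < 1) :
    ∃ θ : ℝ, p < θ ∧ θ < 1 ∧ ∃ G : ℕ,
      1 ≤ ∑ g ∈ Finset.range G, τ * (2 * ((g + 1 : ℕ) : ℝ))⁻¹ * p ^ g * θ⁻¹ ^ (g + 1) := by
  have hdiv := Real.tendsto_sum_range_one_div_nat_succ_atTop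
  obtain ⟨G, hG⟩ := (hdiv.eventually (eventually_gt_atTop (2 * p / τ))).exists
  have hval : 1 < ∑ g ∈ Finset.range G, τ * (2 * ((g + 1 : ℕ) : ℝ))⁻¹ * p ^ g * p⁻¹ ^ (g + 1) := by
    have h1 : ∀ g : ℕ, τ * (2 * ((g + 1 : ℕ) : ℝ))⁻¹ * p ^ g * p⁻¹ ^ (g + 1) =
        τ / (2 * p) * (1 / ((g : ℝ) + 1)) := by
      intro g
      push_cast
      rw [inv_pow, pow_succ]
      field_simp
    simp only [h1, ← Finset.mul_sum]
    calc (1 : ℝ) = τ / (2 * p) * (2 * p / τ) := by field_simp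
      _ < _ := by
        refine mul_lt_mul_of_pos_left hG (by positivity)
  have hcont : ContinuousAt (fun θ : ℝ =>
      ∑ g ∈ Finset.range G, τ * (2 * ((g + 1 : ℕ) : ℝ))⁻¹ * p ^ g * θ⁻¹ ^ (g + 1)) p := by
    have : ∀ g ∈ Finset.range G, ContinuousAt (fun θ : ℝ =>
        τ * (2 * ((g + 1 : ℕ) : ℝ))⁻¹ * p ^ g * θ⁻¹ ^ (g + 1)) p := fun g _ =>
      continuousAt_const.mul ((continuousAt_inv₀ hp.ne').pow _)
    exact tendsto_finsetSum _ this
  have hev := (hcont.eventually (eventually_gt_nhds hval)).filter_mono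
    (nhdsWithin_le_nhds (s := Set.Ioi p))
  obtain ⟨θ, h1, h2⟩ := (hev.and (Ioo_mem_nhdsGT hp1)).exists
  exact ⟨θ, h2.1, h2.2, G, h1.le⟩

theorem tsum_pow_mul_geometric_ne_top (k : ℕ) {z : ℝ≥0∞} (hz : z < 1) :
    ∑' R : ℕ, ((R : ℝ≥0∞) + 1) ^ k * z ^ R ≠ ⊤ := by
  lift z to NNReal using hz.ne_top
  have hz' : (z : ℝ) < 1 := by exact_mod_cast hz
  have hs : Summable fun R : ℕ => (R : NNReal) ^ k * z ^ R := by
    rw [← NNReal.summable_coe]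
    push_cast
    exact summable_pow_mul_geometric_of_norm_lt_one k (by simpa using hz')
  have hs' : ∑' R : ℕ, (R : ℝ≥0∞) ^ k * (z : ℝ≥0∞) ^ R ≠ ⊤ := by
    have := ENNReal.tsum_coe_ne_top_iff_summable.2 hs
    simpa using this
  have hle : ∀ R : ℕ, ((R : ℝ≥0∞) + 1) ^ k * (z : ℝ≥0∞) ^ R ≤
      2 ^ k * ((R : ℝ≥0∞) ^ k * (z : ℝ≥0∞) ^ R) + (z : ℝ≥0∞) ^ R := by
    intro R
    rcases Nat.eq_zero_or_pos R with rfl | hR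
    · simp
    · refine le_trans ?_ le_self_add
      rw [← mul_assoc, ← mul_pow]
      gcongr
      rw [two_mul]
      gcongr
      exact_mod_cast hR
  refine ne_top_of_le_ne_top ?_ (ENNReal.tsum_le_tsum hle)
  rw [ENNReal.tsum_add, ENNReal.tsum_mul_left, ENNReal.tsum_geometric]
  exact ENNReal.add_ne_top.2 ⟨ENNReal.mul_ne_top (ENNReal.pow_ne_top ENNReal.ofNat_ne_top) hs',
    ENNReal.inv_ne_top.2 (tsub_pos_of_lt hz).ne'⟩

/-- Continuity of the measure from above: {1 ≤ g} is the decreasing limit of {u n < g} as u n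
increases to 1. -/
theorem exists_trap_level {Ω : Type*} [MeasurableSpace Ω] {μ : Measure Ω} [IsProbabilityMeasure μ]
    {g : Ω → ℝ≥0∞} (hg : Measurable g) {θ : ℝ≥0∞} (hθ : μ {ω | 1 ≤ g ω} < θ) :
    ∃ ρ : ℝ≥0∞, ρ ≠ 0 ∧ ρ < 1 ∧ μ {ω | ρ < g ω} < θ := by
  obtain ⟨u, hu, hu1, hut⟩ := exists_seq_strictMono_tendsto' (zero_lt_one' ℝ≥0∞)
  have hset : {ω | 1 ≤ g ω} = ⋂ n, {ω | u n < g ω} := by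
    ext ω
    simp only [Set.mem_ofPred_eq, Set.mem_iInter]
    exact ⟨fun h n => (hu1 n).2.trans_le h, fun h => le_of_tendsto' hut fun n => (h n).le⟩
  have hanti : Antitone fun n => {ω | u n < g ω} := fun m n hmn ω hω =>
    lt_of_le_of_lt (hu.monotone hmn) hω
  have ht := tendsto_measure_iInter_atTop (μ := μ)
    (fun n => (measurableSet_lt measurable_const hg).nullMeasurableSet (s := {ω | u n < g ω}))
    hanti ⟨0, measure_ne_top μ _⟩
  rw [← hset] at ht
  obtain ⟨n, hn⟩ := (ht.eventually (eventually_lt_nhds hθ)).exists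
  exact ⟨u n, (hu1 n).1.ne', (hu1 n).2, hn⟩

section Environment
variable {Ω : Type*} [MeasurableSpace Ω] {μ : Measure Ω} [IsProbabilityMeasure μ]
  {f : Lattice 1 → Ω → ℝ≥0∞}

/-- Weights in (0,1) have positive probability, so weights in [κ,1) have positive probability σ for
some κ > 0. The renewal comparison with τ = κσ then gives a rate above p. -/
theorem exists_crossing_rate_of_free (hf : ∀ z, Measurable (f z)) (hind : iIndepFun f μ)
    (hle : ∀ z ω, f z ω ≤ 1)
    (hlaw : ∀ z (A : Set ℝ≥0∞), MeasurableSet A → μ (f z ⁻¹' A) = μ (f 0 ⁻¹' A))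
    (hp0 : μ {ω | 1 ≤ f 0 ω} ≠ 0) (hp1 : μ {ω | 1 ≤ f 0 ω} < 1)
    (hmod : 0 < μ {ω | 0 < f 0 ω ∧ f 0 ω < 1}) :
    ∃ θ c : ℝ≥0∞, μ {ω | 1 ≤ f 0 ω} < θ ∧ θ ≤ 1 ∧ c ≠ 0 ∧ c ≤ 1 ∧ ∀ s a L, 0 < L →
      c * θ ^ L ≤ ∫⁻ ω, crossWeight (fun z => f z ω) s a L ∂μ := by
  set p := μ {ω | 1 ≤ f 0 ω} with hp
  have hpt : p ≠ ⊤ := measure_ne_top μ _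
  obtain ⟨κ, hκ0, hκt, hκ1, hκ⟩ : ∃ κ : ℝ≥0∞, κ ≠ 0 ∧ κ ≠ ⊤ ∧ κ ≤ 1 ∧
      μ (f 0 ⁻¹' Set.Ico κ 1) ≠ 0 := by
    have hsub : {ω | 0 < f 0 ω ∧ f 0 ω < 1} ⊆
        ⋃ n : ℕ, f 0 ⁻¹' Set.Ico ((n : ℝ≥0∞) + 1)⁻¹ 1 := by
      rintro ω ⟨h0, h1⟩
      obtain ⟨n, hn⟩ := ENNReal.exists_inv_nat_lt h0.ne'
      refine Set.mem_iUnion.2 ⟨n, ?_, h1⟩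
      exact le_trans (ENNReal.inv_le_inv.2 le_self_add) hn.le
    have hne : μ (⋃ n : ℕ, f 0 ⁻¹' Set.Ico ((n : ℝ≥0∞) + 1)⁻¹ 1) ≠ 0 :=
      (lt_of_lt_of_le hmod (measure_mono hsub)).ne'
    obtain ⟨n, hn⟩ := exists_measure_pos_of_not_measure_iUnion_null hne
    have h1 : (1 : ℝ≥0∞) ≤ n + 1 := le_add_self
    refine ⟨((n : ℝ≥0∞) + 1)⁻¹, ?_, ?_, ENNReal.inv_le_one.2 h1, hn.ne'⟩
    · exact ENNReal.inv_ne_zero.2 (ENNReal.add_ne_top.2 ⟨ENNReal.natCast_ne_top n,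
        ENNReal.one_ne_top⟩)
    · exact ENNReal.inv_ne_top.2 (lt_of_lt_of_le one_pos h1).ne'
  set σ := μ (f 0 ⁻¹' Set.Ico κ 1) with hσ
  have hσt : σ ≠ ⊤ := measure_ne_top μ _
  have hσ1 : σ ≤ 1 := prob_le_one
  have hmodz : ∀ z, ∫⁻ ω, moderate κ (f z ω) ∂μ = σ := by
    intro z
    rw [hσ, ← hlaw z _ measurableSet_Ico, ← lintegral_indicator_one (hf z measurableSet_Ico)]
    rfl
  have hfreez : ∀ z, ∫⁻ ω, free (f z ω) ∂μ = p := by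
    intro z
    rw [hp, show {ω | 1 ≤ f 0 ω} = f 0 ⁻¹' Set.Ici 1 from rfl, ← hlaw z _ measurableSet_Ici,
      ← lintegral_indicator_one (hf z measurableSet_Ici)]
    rfl
  have hκr : 0 < κ.toReal := ENNReal.toReal_pos hκ0 hκt
  have hσr : 0 < σ.toReal := ENNReal.toReal_pos hκ hσt
  have hpr : 0 < p.toReal := ENNReal.toReal_pos hp0 hpt
  have hpr1 : p.toReal < 1 := by
    simpa using (ENNReal.toReal_lt_toReal hpt ENNReal.one_ne_top).2 hp1
  obtain ⟨t, hpt', ht1, G, hG⟩ := exists_rate_of_pos (mul_pos hκr hσr) hpr hpr1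
  have ht0 : 0 < t := hpr.trans hpt'
  have hsum : 1 ≤ ∑ g ∈ Finset.range G, κ * (2 * ((g + 1 : ℕ) : ℝ≥0∞))⁻¹ * (σ * p ^ g) *
      (ENNReal.ofReal t)⁻¹ ^ (g + 1) := by
    have h1 := ENNReal.ofReal_le_ofReal hG
    rw [ENNReal.ofReal_one, ENNReal.ofReal_sum_of_nonneg fun g _ => by positivity] at h1
    refine h1.trans (le_of_eq (Finset.sum_congr rfl fun g _ => ?_))
    rw [ENNReal.ofReal_mul (by positivity), ENNReal.ofReal_mul (by positivity),
      ENNReal.ofReal_mul (by positivity), ENNReal.ofReal_mul hκr.le,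
      ENNReal.ofReal_pow (by positivity), ENNReal.ofReal_pow (by positivity),
      ENNReal.ofReal_inv_of_pos (by positivity), ENNReal.ofReal_inv_of_pos ht0,
      ENNReal.ofReal_mul two_pos.le, ENNReal.ofReal_natCast, ENNReal.ofReal_toReal hκt,
      ENNReal.ofReal_toReal hσt, ENNReal.ofReal_toReal hpt, ENNReal.ofReal_ofNat]
    ring
  have hinv1 : (2 * ((G + 1 : ℕ) : ℝ≥0∞))⁻¹ ≤ 1 := by
    rw [ENNReal.inv_le_one]; exact_mod_cast (by omega : 1 ≤ 2 * (G + 1))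
  refine ⟨ENNReal.ofReal t, κ * (2 * ((G + 1 : ℕ) : ℝ≥0∞))⁻¹ * (σ * p ^ G), ?_, ?_, ?_, ?_, ?_⟩
  · rwa [ENNReal.lt_ofReal_iff_toReal_lt hpt]
  · simpa using ht1.le
  · exact mul_ne_zero (mul_ne_zero hκ0 (ENNReal.inv_ne_zero.2 (ENNReal.mul_ne_top
      ENNReal.ofNat_ne_top (ENNReal.natCast_ne_top _)))) (mul_ne_zero hκ (pow_ne_zero _ hp0))
  · exact mul_le_one' (mul_le_one' hκ1 hinv1) (mul_le_one' hσ1 (pow_le_one' hp1.le _))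
  · intro s a L hL
    refine (le_lintegral_crossWeight hf hind hle hmodz hfreez (by simpa using ht0)
      (by simpa using ht1.le) hsum (fun g hg => ?_) s L a hL).trans
      (lintegral_mono fun ω => mul_le_of_le_one_left zero_le (moderate_le_one κ _))
    refine mul_le_mul' (mul_le_mul' le_rfl ?_) (mul_le_mul' le_rfl
      (pow_le_pow_of_le_one zero_le hp1.le hg.le))
    rw [ENNReal.inv_le_inv]
    gcongr

/-- If free sites have probability zero, any positive rate will do and a straight path provides one;
otherwise the renewal comparison is used. Sites of the cube are at most 2R apart, whence the
exponent. -/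
theorem exists_crossing_rate (hf : ∀ z, Measurable (f z)) (hind : iIndepFun f μ)
    (hle : ∀ z ω, f z ω ≤ 1) {β : ℝ≥0∞} (hβ0 : β ≠ 0) (hβ1 : β ≤ 1)
    (hβ : ∀ v, ∫⁻ ω, f v ω ∂μ = β)
    (hlaw : ∀ z (A : Set ℝ≥0∞), MeasurableSet A → μ (f z ⁻¹' A) = μ (f 0 ⁻¹' A))
    (hp1 : μ {ω | 1 ≤ f 0 ω} < 1) (hmod : 0 < μ {ω | 0 < f 0 ω ∧ f 0 ω < 1}) :
    ∃ θ c : ℝ≥0∞, μ {ω | 1 ≤ f 0 ω} < θ ∧ θ ≤ 1 ∧ c ≠ 0 ∧ c ≤ 1 ∧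
      ∀ x (R : ℕ), ∀ u ∈ cube x R, ∀ v ∈ cube x R,
        c * θ ^ (2 * R) ≤ ∫⁻ ω, innerWeight (fun z => f z ω) (cube x R) u v ∂μ := by
  by_cases hp0 : μ {ω | 1 ≤ f 0 ω} = 0
  · have hγ1 : (2 * ((1 : ℕ) : ℝ≥0∞))⁻¹ * β ≤ 1 := by
      refine mul_le_one' (ENNReal.inv_le_one.2 ?_) hβ1
      exact_mod_cast one_le_two
    refine ⟨(2 * ((1 : ℕ) : ℝ≥0∞))⁻¹ * β, 1, ?_, hγ1, one_ne_zero, le_rfl, ?_⟩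
    · rw [hp0, pos_iff_ne_zero]
      exact mul_ne_zero (ENNReal.inv_ne_zero.2 (ENNReal.mul_ne_top ENNReal.ofNat_ne_top
        (ENNReal.natCast_ne_top 1))) hβ0
    · intro x R u hu v hv
      rw [one_mul]
      refine (pow_le_pow_of_le_one zero_le hγ1 (distOne_le_of_mem_cube hu hv)).trans ?_
      refine (le_lintegral_innerWeight hf hind hβ (mem_Icc_of_mem_cube hu)
        (mem_Icc_of_mem_cube hv)).trans (le_of_eq ?_)
      simp only [cube, Finset.coe_Icc]
  · obtain ⟨θ, c, h1, h2, h3, h4, h5⟩ :=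
      exists_crossing_rate_of_free hf hind hle hlaw hp0 hp1 hmod
    refine ⟨θ, c, h1, h2, h3, h4, fun x R u hu v hv => ?_⟩
    by_cases huv : u = v
    · subst huv
      calc c * θ ^ (2 * R) ≤ ∫⁻ _, 1 ∂μ := by
            simpa using mul_le_one' h4 (pow_le_one' h2 _)
        _ ≤ _ := lintegral_mono fun ω => innerWeight_self _ _ u
    · set s : Fin 1 × Bool := (0, decide (u 0 < v 0)) with hs
      have hstep : ∀ k : ℕ, (k • unitStep s) 0 = k * (if u 0 < v 0 then 1 else -1) := by
        intro k
        rw [Pi.smul_apply, nsmul_eq_mul]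
        simp only [unitStep, hs, Pi.single_eq_same, decide_eq_true_eq]
      set L := (v 0 - u 0).natAbs with hL
      have hend : u + L • unitStep s = v := by
        ext i
        rw [Subsingleton.elim i 0]
        rw [Pi.add_apply, hstep]
        split_ifs <;> omega
      have hL0 : 0 < L := by
        refine Nat.pos_of_ne_zero fun h => huv ?_
        rw [← hend, h, zero_smul, add_zero]
      have hu' := abs_le.1 (mem_cube.1 hu 0)
      have hv' := abs_le.1 (mem_cube.1 hv 0)
      have hLR : L ≤ 2 * R := by omega
      have hsub : halfLine s u L ⊆ (cube x R : Set (Lattice 1)) := by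
        rintro z ⟨k, hk, rfl⟩
        refine Finset.mem_coe.2 (mem_cube.2 fun i => ?_)
        rw [Subsingleton.elim i 0, abs_le]
        rw [Pi.add_apply, hstep]
        split_ifs <;> omega
      refine (mul_le_mul' le_rfl (pow_le_pow_of_le_one zero_le h2 hLR)).trans
        ((h5 s u L hL0).trans (lintegral_mono fun ω => ?_))
      rw [crossWeight, hend]
      exact innerWeight_mono _ hsub u v

/-- Absence of traps and crossing both decay exponentially in 2R. A trap level with q < θ makes the
first decay faster, and the linear bound on the Green function and the volume factors are only
polynomial. -/
theorem exists_lintegral_le_through_of_one (hf : ∀ z, Measurable (f z)) (hind : iIndepFun f μ)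
    (hle : ∀ z ω, f z ω ≤ 1) {β : ℝ≥0∞} (hβ0 : β ≠ 0) (hβ1 : β ≤ 1)
    (hβ : ∀ v, ∫⁻ ω, f v ω ∂μ = β)
    (hlaw : ∀ z (A : Set ℝ≥0∞), MeasurableSet A → μ (f z ⁻¹' A) = μ (f 0 ⁻¹' A))
    (hp1 : μ {ω | 1 ≤ f 0 ω} < 1) (hmod : 0 < μ {ω | 0 < f 0 ω ∧ f 0 ω < 1}) :
    ∃ C : ℝ≥0∞, C ≠ ⊤ ∧ ∀ o y : Lattice 1,
      ∫⁻ ω, green (({y}ᶜ : Set (Lattice 1)).indicator fun z => f z ω)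
        (green (({y}ᶜ : Set (Lattice 1)).indicator fun z => f z ω) (Pi.single y 1)) o ∂μ ≤
      C * ∑' u, ∫⁻ ω, throughWeight (fun z => f z ω) o y u ∂μ := by
  obtain ⟨θ, c, hpθ, hθ1, hc0, hc1, hcross⟩ :=
    exists_crossing_rate hf hind hle hβ0 hβ1 hβ hlaw hp1 hmod
  obtain ⟨ρ, -, hρ, hqθ⟩ := exists_trap_level (hf 0) hpθ
  set q := μ {ω | ρ < f 0 ω} with hq
  have hq' : ∀ z, μ {ω | ρ < f z ω} = q := fun z => hlaw z (Set.Ioi ρ) measurableSet_Ioi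
  -- Unlike q, r is certainly nonzero, so r⁻¹ can make up for the exponent 2R - 1 in place of 2R.
  obtain ⟨r, hqr, hrθ⟩ := exists_between hqθ
  have hr0 : r ≠ 0 := (lt_of_le_of_lt zero_le hqr).ne'
  have hr1 : r ≤ 1 := hrθ.le.trans hθ1
  have hθ0 : θ ≠ 0 := (lt_of_le_of_lt zero_le hrθ).ne'
  have hθt : θ ≠ ⊤ := ne_top_of_le_ne_top ENNReal.one_ne_top hθ1
  have hct : c ≠ ⊤ := ne_top_of_le_ne_top ENNReal.one_ne_top hc1
  have hK0 : (1 - ρ)⁻¹ ≠ ⊤ := ENNReal.inv_ne_top.2 (tsub_pos_of_lt hρ).ne'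
  refine lintegral_green_green_le_through hf hind hle hβ0 hβ1 hβ hq' (hqθ.trans_le hθ1)
    (fun R => (1 - ρ)⁻¹ + 4 * R) (fun R => c * θ ^ (2 * R))
    (fun R => mul_ne_zero hc0 (pow_ne_zero _ hθ0))
    (fun R => ENNReal.mul_ne_top hct (ENNReal.pow_ne_top hθt)) ?_ hcross ?_
  · rintro x R ω ⟨t, ht, hft⟩ v hv u
    refine (green_single_le_one_dim (fun z => hle z ω) hρ hft u v).trans (add_le_add le_rfl ?_)
    have := distOne_le_of_mem_cube hv ht
    exact_mod_cast (by omega : 2 * distOne v t ≤ 4 * R)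
  · set A : ℝ≥0∞ := (1 - ρ)⁻¹ + 4 with hA
    have hAt : A ≠ ⊤ := ENNReal.add_ne_top.2 ⟨hK0, ENNReal.ofNat_ne_top⟩
    have hz : (r * θ⁻¹) ^ 2 < 1 := by
      refine pow_lt_one₀ zero_le ?_ two_ne_zero
      rw [← div_eq_mul_inv]
      exact ENNReal.div_lt_of_lt_mul' (by simpa using hrθ)
    have hterm : ∀ R : ℕ, (c * θ ^ (2 * R))⁻¹ * ((1 - ρ)⁻¹ + 4 * R) ^ 2 *
        q ^ (2 * R - 1) ^ 1 * (2 * R + 1) ^ (2 * 1) ≤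
        (c⁻¹ * r⁻¹ * A ^ 2 * 4) * (((R : ℝ≥0∞) + 1) ^ 4 * ((r * θ⁻¹) ^ 2) ^ R) := by
      intro R
      have h1 : (c * θ ^ (2 * R))⁻¹ = c⁻¹ * θ⁻¹ ^ (2 * R) := by
        rw [ENNReal.mul_inv (Or.inl hc0) (Or.inl hct), ENNReal.inv_pow]
      have h2 : (1 - ρ)⁻¹ + 4 * R ≤ A * ((R : ℝ≥0∞) + 1) := by
        rw [hA, mul_add, mul_one, add_mul, add_comm]
        refine add_le_add le_add_self le_self_add
      have h3 : q ^ (2 * R - 1) ^ 1 ≤ r⁻¹ * r ^ (2 * R) := by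
        rw [pow_one]
        refine (pow_le_pow_left' hqr.le _).trans ?_
        rw [← ENNReal.mul_le_iff_le_inv hr0 (ne_top_of_le_ne_top ENNReal.one_ne_top hr1),
          ← pow_succ']
        exact pow_le_pow_of_le_one zero_le hr1 (by omega)
      have h4 : (2 * (R : ℝ≥0∞) + 1) ≤ 2 * (R + 1) := by
        rw [mul_add, mul_one]
        exact add_le_add le_rfl one_le_two
      rw [h1]
      calc _ ≤ c⁻¹ * θ⁻¹ ^ (2 * R) * (A * ((R : ℝ≥0∞) + 1)) ^ 2 * (r⁻¹ * r ^ (2 * R)) *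
            (2 * ((R : ℝ≥0∞) + 1)) ^ (2 * 1) :=
            mul_le_mul' (mul_le_mul' (mul_le_mul' le_rfl (pow_le_pow_left' h2 _)) h3)
              (pow_le_pow_left' h4 _)
        _ = _ := by
            clear_value A
            generalize c⁻¹ = c'
            generalize r⁻¹ = r'
            generalize θ⁻¹ = θ'
            ring
    refine ne_top_of_le_ne_top ?_ (ENNReal.tsum_le_tsum hterm)
    rw [ENNReal.tsum_mul_left]
    refine ENNReal.mul_ne_top (ENNReal.mul_ne_top (ENNReal.mul_ne_top (ENNReal.mul_ne_top
      (ENNReal.inv_ne_top.2 hc0) (ENNReal.inv_ne_top.2 hr0)) (ENNReal.pow_ne_top hAt))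
      ENNReal.ofNat_ne_top) (tsum_pow_mul_geometric_ne_top 4 hz)

end Environment

end RWPotential

end

/-! ### Passage from the potential to the survival weights. -/

theorem theorem1p1 {d : ℕ} [NeZero d] {Ω : Type*} [MeasurableSpace Ω]
    (μ : Measure Ω) [IsProbabilityMeasure μ]
    (V : RWPotential.Lattice d → Ω → ℝ≥0∞)
    (hmeas : ∀ z, Measurable (V z))
    (hindep : iIndepFun V μ)
    (hident : ∀ z, IdentDistrib (V z) (V 0) μ μ)
    (hpos : μ {ω | V 0 ω = 0} < 1)
    (hinf : essInf (V 0) μ = 0)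
    (hone : d = 1 → 0 < μ {ω | 0 < V 0 ω ∧ V 0 ω < ∞}) :
    ∃ C : ℝ, 0 < C ∧
      limsup (fun y : RWPotential.Lattice d =>
          RWPotential.annealedHitTime μ V 0 y / ENNReal.ofReal (RWPotential.latticeNorm y))
        (comap RWPotential.latticeNorm atTop) ≤ ENNReal.ofReal C := by
  open RWPotential in
  set f : Lattice d → Ω → ℝ≥0∞ := fun z ω => survival (fun z => V z ω) z with hfdef
  have hexp : Measurable fun t : ℝ≥0∞ => EReal.exp (-(t : EReal)) :=
    measurable_coe_ennreal_ereal.neg.ereal_exp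
  have hf : ∀ z, Measurable (f z) := survival_measurable hmeas
  have hle : ∀ z ω, f z ω ≤ 1 := fun z ω => survival_le_one _ z
  have hind : iIndepFun f μ := hindep.comp (fun _ t => EReal.exp (-(t : EReal))) fun _ => hexp
  have hid : ∀ z, IdentDistrib (f z) (f 0) μ μ := fun z => (hident z).comp hexp
  have hlaw : ∀ z (A : Set ℝ≥0∞), MeasurableSet A → μ (f z ⁻¹' A) = μ (f 0 ⁻¹' A) :=
    fun z A hA => (hid z).measure_mem_eq hA
  have hone_le : ∀ ω, 1 ≤ f 0 ω ↔ V 0 ω = 0 := by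
    intro ω
    simp only [hfdef, survival]
    rw [EReal.one_le_exp_iff, EReal.neg_nonneg, ← EReal.coe_ennreal_zero, EReal.coe_ennreal_le_coe_ennreal_iff, nonpos_iff_eq_zero]
  have hpos_iff : ∀ ω, 0 < f 0 ω ↔ V 0 ω < ∞ := by
    intro ω
    simp [hfdef, survival, bot_lt_iff_ne_bot, lt_top_iff_ne_top]
  have hp1 : μ {ω | 1 ≤ f 0 ω} < 1 := by simpa only [hone_le] using hpos
  set β := ∫⁻ ω, f 0 ω ∂μ with hβdef
  have hβ : ∀ z, ∫⁻ ω, f z ω ∂μ = β := fun z => (hid z).lintegral_eq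
  -- Were β zero, V would be almost surely infinite, against its essential infimum being 0.
  have hβ0 : β ≠ 0 := by
    intro h
    rw [hβdef, lintegral_eq_zero_iff (hf 0)] at h
    have htop : V 0 =ᵐ[μ] fun _ => ∞ := by
      filter_upwards [h] with ω hω
      by_contra hne
      exact ((hpos_iff ω).2 (lt_top_iff_ne_top.2 hne)).ne' hω
    rw [essInf_congr_ae htop, essInf_const_top] at hinf
    exact ENNReal.top_ne_zero hinf
  have hβle : β ≤ 1 := (lintegral_mono (hle 0)).trans (by simp)
  have hβ1 : β < 1 := by
    by_contra hge
    have hβe : β = 1 := le_antisymm hβle (not_lt.1 hge)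
    have hae : f 0 =ᵐ[μ] fun _ => 1 := by
      refine ae_eq_of_ae_le_of_lintegral_le (Eventually.of_forall (hle 0)) ?_
        aemeasurable_const ?_
      · rw [← hβdef, hβe]; exact ENNReal.one_ne_top
      · rw [← hβdef, hβe]; simp
    refine hp1.ne (le_antisymm prob_le_one ?_)
    calc (1 : ℝ≥0∞) = μ Set.univ := measure_univ.symm
      _ ≤ μ {ω | 1 ≤ f 0 ω} := measure_mono_ae (by filter_upwards [hae] with ω hω _; exact hω.ge)
  refine limsup_annealedHitTime_le μ hmeas hind hβ0 hβ1 hβ ?_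
  -- Above dimension one any level ρ < 1 at which traps have positive probability serves. In
  -- dimension one `hone` provides the weights strictly between 0 and 1.
  rcases Nat.lt_or_ge 1 d with hd | hd
  · obtain ⟨ρ, hρ0, hρ, hq⟩ := exists_trap_level (hf 0) hp1
    exact exists_lintegral_le_through_of_two_le hd hf hind hle hβ0 hβle hβ hρ0 hρ
      (fun z => hlaw z (Set.Ioi ρ) measurableSet_Ioi) hq
  · obtain rfl : d = 1 := le_antisymm hd (Nat.pos_of_ne_zero (NeZero.ne d))
    refine exists_lintegral_le_through_of_one hf hind hle hβ0 hβle hβ hlaw hp1 ?_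
    refine lt_of_lt_of_le (hone rfl) (measure_mono fun ω hω => ⟨(hpos_iff ω).2 hω.2, ?_⟩)
    exact not_le.1 fun h => hω.1.ne' ((hone_le ω).1 h)
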